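/- For $\xi\in\mathbb R^2$, let $\lambda_1(\xi)$ be the unique nonnegative real root, $\lambda_2(\xi)$ the unique root with positive real part and positive imaginary part, and $\lambda_3(\xi)=\overline{\lambda_2(\xi)}$, of the equation $-\lambda^2-(\lambda^2-|\xi|^2)^3=0$, that is, of $\det\begin{pmatrix}\lambda&\lambda^2-|\xi|^2\\(\lambda^2-|\xi|^2)^2&-\lambda\end{pmatrix}=0$. Let $L^1_{uloc}(\mathbb R^2)$ be the space of measurable $u:\mathbb R^2\to\mathbb C$ with $\|u\|_{L^1_{uloc}}:=\sup_{q\in\mathbb Z^2}\int_{B(q,1)}|u|<\infty$, and let $\mathbb R^3_+=\mathbb R^2\times(0,\infty)$. **Lemma.** Let $\chi\in C_c^\infty(\mathbb R^2)$ and let $P\in C^\infty(\mathbb R^2\setminus\{0\})$ be such that $$P(\xi)=p_k(\xi)\,|\xi|^{\alpha-k}\,Q(\xi)\quad\text{for all }\xi\ne0\text{ near }0,$$ where $p_k$ is a homogeneous polynomial of degree $k\in\mathbb N$ in $\xi_1,\xi_2$, $\alpha>0$ is real, $\alpha-k\ge-2$, and $Q\in C^\infty(\mathbb R^2)$ (all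 functions and coefficients complex-valued). Then: 1. For $i=1,2,3$ and $z>0$, the symbol $\chi(\xi)P(\xi)e^{-\lambda_i(\xi)z}$ is integrable on $\mathbb R^2$ and the kernel $K^i(x,z)=(2\pi)^{-2}\int_{\mathbb R^2}e^{ix\cdot\xi}\chi(\xi)P(\xi)e^{-\lambda_i(\xi)z}\,d\xi$ is in $L^1(\mathbb R^2)$ as a function of $x$. For every $u_0\in L^1_{uloc}(\mathbb R^2)$ the convolution $u^i(\cdot,z)=\chi(D)P(D)e^{-\lambda_i(D)z}u_0:=K^i(\cdot,z)\star u_0$ is given by an absolutely convergent integral at every point, and $u^i(\cdot,z)\in L^\infty(\mathbb R^2)$. 2. There are $C\ge0$ and $\delta>0$ such that, for every $u_0\in L^1_{uloc}(\mathbb R^2)$, the functions $e^{\delta z}u^2$ and $e^{\delta z}u^3$ are in $L^\infty(\mathbb R^3_+)$ and $$\|e^{\delta z}u^2\|_{L^\infty(\mathbb R^3_+)}+\|e^{\delta z}u^3\|_{L^\infty(\mathbb R^3_+)}\le C\,\|u_0\|_{L^1_{uloc}}.$$ 3. There is $C\ge0$ such that, for every $u_0\in L^1_{uloc}(\mathbb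 R^2)$, the function $(1+z)^{\alpha/3}u^1$ is in $L^\infty(\mathbb R^3_+)$ and $$\|(1+z)^{\alpha/3}u^1\|_{L^\infty(\mathbb R^3_+)}\le C\,\|u_0\|_{L^1_{uloc}}.$$ -/

import Mathlib

open MeasureTheory Filter Topology
open scoped ENNReal NNReal ContDiff ComplexConjugate

/-- The plane of horizontal variables (physical and frequency side), with its Euclidean norm. -/
abbrev Plane : Type := EuclideanSpace ℝ (Fin 2)

/-- The matrix `L(ξ, ζ)` of the Orr-Sommerfeld form of the Stokes-Coriolis system, where the
vertical derivative is replaced by the complex number `ζ`. -/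
noncomputable def orrSommerfeld (ξ : Plane) (ζ : ℂ) : Matrix (Fin 2) (Fin 2) ℂ :=
  !![ζ, ζ ^ 2 - (‖ξ‖ : ℂ) ^ 2; (ζ ^ 2 - (‖ξ‖ : ℂ) ^ 2) ^ 2, -ζ]

/-- `ζ` is a root of the characteristic equation `det L(ξ, ζ) = 0`. -/
def IsCharRoot (ξ : Plane) (ζ : ℂ) : Prop := (orrSommerfeld ξ ζ).det = 0

theorem isCharRoot_iff (ξ : Plane) (ζ : ℂ) :
    IsCharRoot ξ ζ ↔ -ζ ^ 2 - (ζ ^ 2 - (‖ξ‖ : ℂ) ^ 2) ^ 3 = 0 := by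
  unfold IsCharRoot orrSommerfeld
  rw [Matrix.det_fin_two_of]
  constructor <;> intro h <;> linear_combination h

theorem isCharRoot_ofReal_iff (ξ : Plane) (r : ℝ) :
    IsCharRoot ξ (r : ℂ) ↔ r ^ 2 + (r ^ 2 - ‖ξ‖ ^ 2) ^ 3 = 0 := by
  rw [isCharRoot_iff]
  constructor
  · intro h
    have h' : ((r ^ 2 + (r ^ 2 - ‖ξ‖ ^ 2) ^ 3 : ℝ) : ℂ) = 0 := by
      push_cast
      linear_combination -h
    exact_mod_cast h'
  · intro h
    have h' : ((r ^ 2 + (r ^ 2 - ‖ξ‖ ^ 2) ^ 3 : ℝ) : ℂ) = 0 := by exact_mod_cast h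
    push_cast at h'
    linear_combination -h'

/-- There is exactly one nonnegative real characteristic root. -/
theorem existsUnique_charRoot₁ (ξ : Plane) : ∃! r : ℝ, 0 ≤ r ∧ IsCharRoot ξ (r : ℂ) := by
  have hs : 0 ≤ ‖ξ‖ := norm_nonneg ξ
  have hivt := intermediate_value_Icc (f := fun r : ℝ => r ^ 2 + (r ^ 2 - ‖ξ‖ ^ 2) ^ 3) hs
    (by fun_prop)
  have h0 : (0 : ℝ) ∈ Set.Icc ((0 : ℝ) ^ 2 + ((0 : ℝ) ^ 2 - ‖ξ‖ ^ 2) ^ 3)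
      (‖ξ‖ ^ 2 + (‖ξ‖ ^ 2 - ‖ξ‖ ^ 2) ^ 3) := by
    constructor
    · have : 0 ≤ ‖ξ‖ ^ 6 := by positivity
      nlinarith
    · have : 0 ≤ ‖ξ‖ ^ 2 := by positivity
      nlinarith
  obtain ⟨r, hr, hr0⟩ := hivt h0
  refine ⟨r, ⟨hr.1, (isCharRoot_ofReal_iff ξ r).2 hr0⟩, ?_⟩
  rintro t ⟨ht, htr⟩
  rw [isCharRoot_ofReal_iff] at htr
  simp only at hr0
  have key : (t ^ 2 - r ^ 2) * (1 + ((t ^ 2 - ‖ξ‖ ^ 2) ^ 2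
      + (t ^ 2 - ‖ξ‖ ^ 2) * (r ^ 2 - ‖ξ‖ ^ 2) + (r ^ 2 - ‖ξ‖ ^ 2) ^ 2)) = 0 := by
    linear_combination htr - hr0
  rcases mul_eq_zero.1 key with h | h
  · exact (sq_eq_sq₀ ht hr.1).1 (by linarith)
  · exfalso
    nlinarith [sq_nonneg ((t ^ 2 - ‖ξ‖ ^ 2) + (r ^ 2 - ‖ξ‖ ^ 2)),
      sq_nonneg (t ^ 2 - ‖ξ‖ ^ 2), sq_nonneg (r ^ 2 - ‖ξ‖ ^ 2)]

/-- There is exactly one characteristic root with positive real and imaginary parts. -/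
theorem existsUnique_charRoot₂ (ξ : Plane) :
    ∃! w : ℂ, (0 < w.re ∧ 0 < w.im) ∧ IsCharRoot ξ w := by
  obtain ⟨r, ⟨-, hr⟩, -⟩ := existsUnique_charRoot₁ ξ
  rw [isCharRoot_iff] at hr
  set s : ℂ := (‖ξ‖ : ℂ) ^ 2 with hsdef
  have hsim : s.im = 0 := by rw [hsdef]; norm_cast
  obtain ⟨Y, hY, hYr⟩ : ∃ Y : ℝ, (Y : ℂ) = (r : ℂ) ^ 2 - s ∧ (Y : ℂ) ^ 3 + Y + s = 0 := by
    refine ⟨r ^ 2 - ‖ξ‖ ^ 2, ?_, ?_⟩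
    · rw [hsdef]; push_cast; ring
    · have : ((r ^ 2 - ‖ξ‖ ^ 2 : ℝ) : ℂ) = (r : ℂ) ^ 2 - s := by rw [hsdef]; push_cast; ring
      rw [this]
      linear_combination -hr
  -- the quadratic factor that carries the two non-real roots
  have hfac : ∀ w : ℂ, 0 < w.re ∧ 0 < w.im → IsCharRoot ξ w →
      (w ^ 2 - s) ^ 2 + Y * (w ^ 2 - s) + (Y ^ 2 + 1) = 0 ∧ 0 < (w ^ 2 - s).im := by
    intro w hw hroot
    rw [isCharRoot_iff] at hroot
    have him : 0 < (w ^ 2 - s).im := by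
      rw [Complex.sub_im, hsim, pow_two, Complex.mul_im]
      nlinarith [mul_pos hw.1 hw.2]
    refine ⟨?_, him⟩
    have hp : ((w ^ 2 - s) - Y) * ((w ^ 2 - s) ^ 2 + Y * (w ^ 2 - s) + (Y ^ 2 + 1)) = 0 := by
      linear_combination -hroot - hYr
    rcases mul_eq_zero.1 hp with h | h
    · exfalso
      have := congrArg Complex.im h
      rw [Complex.sub_im, Complex.ofReal_im, Complex.zero_im] at this
      linarith
    · exact h
  have hexists : ∃ w : ℂ, (0 < w.re ∧ 0 < w.im) ∧ IsCharRoot ξ w := by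
    set d : ℝ := Real.sqrt (3 * Y ^ 2 + 4) with hd
    have hdpos : 0 < d := Real.sqrt_pos.2 (by positivity)
    have hdsq : (d : ℂ) ^ 2 = 3 * (Y : ℂ) ^ 2 + 4 := by
      have : d ^ 2 = 3 * Y ^ 2 + 4 := Real.sq_sqrt (by positivity)
      exact_mod_cast this
    set y : ℂ := -(Y : ℂ) / 2 + (d : ℂ) / 2 * Complex.I with hy
    have hyim : y.im = d / 2 := by simp [hy]
    have hyq : y ^ 2 + Y * y + (Y ^ 2 + 1) = 0 := by
      rw [hy]
      linear_combination (d : ℂ) ^ 2 / 4 * Complex.I_sq - hdsq / 4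
    have hyc : y ^ 3 + y + s = 0 := by
      linear_combination (y - Y) * hyq + hYr
    obtain ⟨w, hw⟩ := IsAlgClosed.exists_pow_nat_eq (y + s) (n := 2) (by norm_num)
    have hwim : 2 * (w.re * w.im) = d / 2 := by
      have := congrArg Complex.im hw
      rw [pow_two, Complex.mul_im, Complex.add_im, hsim, hyim] at this
      linarith
    have hroot : ∀ v : ℂ, v ^ 2 = y + s → IsCharRoot ξ v := by
      intro v hv
      rw [isCharRoot_iff, hv]
      linear_combination -hyc
    have hpos : 0 < w.re * w.im := by linarith
    rcases pos_and_pos_or_neg_and_neg_of_mul_pos hpos with h | h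
    · exact ⟨w, h, hroot w hw⟩
    · refine ⟨-w, ⟨?_, ?_⟩, hroot (-w) (by rw [neg_sq, hw])⟩
      · rw [Complex.neg_re]; linarith [h.1]
      · rw [Complex.neg_im]; linarith [h.2]
  obtain ⟨w, hw, hwr⟩ := hexists
  refine ⟨w, ⟨hw, hwr⟩, ?_⟩
  rintro v ⟨hv, hvr⟩
  obtain ⟨h1, h1'⟩ := hfac w hw hwr
  obtain ⟨h2, h2'⟩ := hfac v hv hvr
  have hprod : (v ^ 2 - w ^ 2) * ((v ^ 2 - s) + (w ^ 2 - s) + Y) = 0 := by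
    linear_combination h2 - h1
  have hne : (v ^ 2 - s) + (w ^ 2 - s) + (Y : ℂ) ≠ 0 := by
    intro h
    have := congrArg Complex.im h
    rw [Complex.add_im, Complex.add_im, Complex.ofReal_im, Complex.zero_im] at this
    linarith
  have hsq : v ^ 2 = w ^ 2 := sub_eq_zero.1 ((mul_eq_zero.1 hprod).resolve_right hne)
  rcases sq_eq_sq_iff_eq_or_eq_neg.1 hsq with h | h
  · exact h
  · exfalso
    have := congrArg Complex.re h
    rw [Complex.neg_re] at this
    linarith [hv.1, hw.1]

/-- `λ₁(ξ)`: the nonnegative real characteristic root. -/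
noncomputable def charRoot₁ (ξ : Plane) : ℂ := ((existsUnique_charRoot₁ ξ).choose : ℂ)

/-- `λ₂(ξ)`: the characteristic root with positive real part and positive imaginary part. -/
noncomputable def charRoot₂ (ξ : Plane) : ℂ := (existsUnique_charRoot₂ ξ).choose

/-- `λ₃(ξ)`: the complex conjugate of `λ₂(ξ)`. -/
noncomputable def charRoot₃ (ξ : Plane) : ℂ := conj (charRoot₂ ξ)

/-- The norm of `L¹_uloc(ℝ²)`: supremum over `k ∈ ℤ²` of the integral of `|u|` over `B(k, 1)`. -/
noncomputable def l1ulocNorm (u : Plane → ℂ) : ℝ≥0∞ :=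
  ⨆ k : Fin 2 → ℤ, ∫⁻ x in Metric.ball (WithLp.toLp 2 fun j => (k j : ℝ) : Plane) 1, ‖u x‖ₑ

/-- Membership in `L¹_uloc(ℝ²)`. -/
def MemL1uloc (u : Plane → ℂ) : Prop :=
  AEStronglyMeasurable u volume ∧ l1ulocNorm u < ⊤

/-- The symbol `χ(ξ) P(ξ) exp(-l(ξ) z)`. -/
noncomputable def decaySymbol (χ P l : Plane → ℂ) (z : ℝ) (ξ : Plane) : ℂ :=
  χ ξ * P ξ * Complex.exp (-(l ξ) * z)

/-- The inverse Fourier transform on `ℝ²`, in the normalization for which `D = -i∇` has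
symbol `ξ`. -/
noncomputable def invFourier (m : Plane → ℂ) (x : Plane) : ℂ :=
  (1 / (2 * (Real.pi : ℂ)) ^ 2) * ∫ ξ : Plane, Complex.exp (Complex.I * (inner ℝ x ξ : ℝ)) * m ξ

/-- The convolution kernel of the Fourier multiplier `χ(D) P(D) exp(-l(D) z)`. -/
noncomputable def decayKernel (χ P l : Plane → ℂ) (z : ℝ) : Plane → ℂ :=
  invFourier (decaySymbol χ P l z)

/-- `χ(D) P(D) exp(-l(D) z) u₀`, the convolution of the kernel at height `z` with `u₀`. -/
noncomputable def decayEvolution (χ P l : Plane → ℂ) (u₀ : Plane → ℂ) (z : ℝ) : Plane → ℂ :=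
  convolution (decayKernel χ P l z) u₀ (ContinuousLinearMap.mul ℂ ℂ) volume

/-- Lebesgue measure on the half-space `ℝ³₊ = ℝ² × (0, ∞)`. -/
noncomputable def halfSpaceVolume : Measure (Plane × ℝ) :=
  (volume : Measure (Plane × ℝ)).restrict {y | 0 < y.2}

/-! The amplitude `a = χ P` behaves at the origin like a function homogeneous of degree `α`: its
derivatives of order `i ≤ 3` are `O(|ξ|^(α - i))`. With `Y = λ² - |ξ|²` the characteristic equation
becomes `Y³ + Y + |ξ|² = 0`, which is solved in closed form. Hence `λ₁` is `|ξ|³` times a smooth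
positive function, while `λ₂` and `λ₃` are smooth and their real parts are bounded below on the
support of `χ`. Thus `a e^(-λ z)` keeps the symbol bounds of order `α`, with a gain `exp(-(c/2) z
|ξ|^b)`, where `b = 3` for `λ₁` and `b = 0` for the others (`exists_symbolBoundAt_mul_cexp`).

The singularity of `a` at the origin limits the decay of the kernel, but since `α > 0` it still
decays like `|x|^(-2-ε)`, which is integrable on the plane (`exists_norm_invFourier_le`). On the
length scale `L = L(z) ≥ 1`, with amplitude `W = W(z)`, this gives `|K(x,z)| ≲ W L^(-2-α) (1 +
|x|/L)^(-2-ε)` (`exists_norm_invFourier_le_weight`). Convolving the weight with `L¹_uloc` data costs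
the area factor `L²` (`exists_lintegral_weight_mul_le`), so the evolution is bounded by `W L^(-α)`
(`decayEvolution_bounds`). For `λ₁` one takes `L = (1+z)^(1/3)` and `W = 1`; for `λ₂` and `λ₃`, `L =
1` and `W = e^(-cz/2)`. -/

/-! ### Calculus of symbol bounds with at most three derivatives. -/

/-- The derivatives of `f` at `ξ` of order `i ≤ 3` are bounded by `A * D ^ i`. -/
def SymbolBoundAt (f : Plane → ℂ) (ξ : Plane) (A D : ℝ) : Prop :=
  ∀ i : ℕ, i ≤ 3 → ‖iteratedFDeriv ℝ i f ξ‖ ≤ A * D ^ i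

theorem isOpen_punctured : IsOpen ({0}ᶜ : Set Plane) := isOpen_compl_singleton

theorem SymbolBoundAt.mono {f : Plane → ℂ} {ξ : Plane} {A A' D D' : ℝ}
    (h : SymbolBoundAt f ξ A D) (hA : A ≤ A') (hA' : 0 ≤ A') (hD : 0 ≤ D) (hDD : D ≤ D') :
    SymbolBoundAt f ξ A' D' := fun i hi =>
  (h i hi).trans (mul_le_mul hA (pow_le_pow_left₀ hD hDD i) (pow_nonneg hD i) hA')

theorem SymbolBoundAt.congr {f g : Plane → ℂ} {ξ : Plane} {A D : ℝ}
    (h : SymbolBoundAt f ξ A D) (hfg : f =ᶠ[𝓝 ξ] g) : SymbolBoundAt g ξ A D := fun i hi => by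
  rw [← (hfg.iteratedFDeriv ℝ i).eq_of_nhds]
  exact h i hi

/-- Leibniz' rule summed by the binomial theorem; the geometric form `A * D ^ i` of the bounds is
what makes the sum close up without extra constants. -/
theorem SymbolBoundAt.mul {f g : Plane → ℂ} {ξ : Plane} {A B D E : ℝ}
    (hf : SymbolBoundAt f ξ A D) (hg : SymbolBoundAt g ξ B E)
    (hfs : ContDiffOn ℝ ∞ f {0}ᶜ) (hgs : ContDiffOn ℝ ∞ g {0}ᶜ) (hξ : ξ ≠ 0) :
    SymbolBoundAt (fun η => f η * g η) ξ (A * B) (D + E) := by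
  intro n hn
  have h := norm_iteratedFDerivWithin_mul_le hfs hgs isOpen_punctured.uniqueDiffOn
    (x := ξ) hξ (n := n) (by exact_mod_cast le_top)
  simp only [iteratedFDerivWithin_of_isOpen _ isOpen_punctured (show ξ ∈ ({0}ᶜ : Set Plane) from hξ)]
    at h
  refine h.trans ?_
  rw [add_pow, Finset.mul_sum]
  refine Finset.sum_le_sum fun i hi => ?_
  have hi' : i ≤ n := Nat.lt_succ_iff.1 (Finset.mem_range.1 hi)
  have h1 := hf i (hi'.trans hn)
  have h2 := hg (n - i) ((Nat.sub_le _ _).trans hn)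
  calc (n.choose i : ℝ) * ‖iteratedFDeriv ℝ i f ξ‖ * ‖iteratedFDeriv ℝ (n - i) g ξ‖
      = (n.choose i : ℝ) * (‖iteratedFDeriv ℝ i f ξ‖ * ‖iteratedFDeriv ℝ (n - i) g ξ‖) := by ring
    _ ≤ (n.choose i : ℝ) * ((A * D ^ i) * (B * E ^ (n - i))) := by
        gcongr
        exact (norm_nonneg _).trans h1
    _ = _ := by ring

theorem norm_iteratedFDeriv_real_cexp (n : ℕ) (w : ℂ) :
    ‖iteratedFDeriv ℝ n Complex.exp w‖ = ‖Complex.exp w‖ := by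
  have h := ContDiffAt.restrictScalars_iteratedFDeriv (𝕜 := ℝ) (𝕜' := ℂ) (n := n)
    (f := Complex.exp) (x := w) Complex.contDiff_exp.contDiffAt
  rw [← h]
  simp [norm_iteratedFDeriv_eq_norm_iteratedDeriv, iteratedDeriv_eq_iterate]

/-- Faà di Bruno's formula costs `n! ≤ 3! = 6`. For orders `i ≥ 1` the factor `z * L` is at most `(1
+ z * L) ^ i`, which puts it into the geometric rate. -/
theorem SymbolBoundAt.cexp_neg_mul {l : Plane → ℂ} {ξ : Plane} {L D : ℝ}
    (hl : SymbolBoundAt l ξ L D) (hls : ContDiffOn ℝ ∞ l {0}ᶜ) (hξ : ξ ≠ 0) (hL : 0 ≤ L)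
    (hD : 0 ≤ D) {z : ℝ} (hz : 0 ≤ z) :
    SymbolBoundAt (fun η => Complex.exp (-(l η) * z)) ξ (6 * Real.exp (-((l ξ).re * z)))
      ((1 + z * L) * D) := by
  intro n hn
  have hmem : ξ ∈ ({0}ᶜ : Set Plane) := hξ
  have hfs : ContDiffOn ℝ ∞ (fun η => -(l η) * (z : ℂ)) {0}ᶜ := hls.neg.mul contDiffOn_const
  have hfd : ∀ i, ‖iteratedFDeriv ℝ i (fun η => -(l η) * (z : ℂ)) ξ‖
      = z * ‖iteratedFDeriv ℝ i l ξ‖ := by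
    intro i
    have : (fun η => -(l η) * (z : ℂ)) = (fun η => (-z) • l η) := by
      ext η; simp; ring
    rw [this, iteratedFDeriv_const_smul_apply'
      ((hls.contDiffAt (isOpen_punctured.mem_nhds hmem)).of_le (by exact_mod_cast le_top)), norm_smul]
    simp [abs_of_nonneg hz]
  have key := norm_iteratedFDerivWithin_comp_le (𝕜 := ℝ) (g := Complex.exp)
    (f := fun η => -(l η) * (z : ℂ)) (n := n) (s := {0}ᶜ) (t := Set.univ) (x := ξ) (N := ∞)
    (C := Real.exp (-((l ξ).re * z))) (D := (1 + z * L) * D)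
    Complex.contDiff_exp.contDiffOn hfs (by exact_mod_cast le_top) uniqueDiffOn_univ
    isOpen_punctured.uniqueDiffOn (Set.mapsTo_univ _ _) hξ
    (by
      intro i _
      rw [iteratedFDerivWithin_univ, norm_iteratedFDeriv_real_cexp, Complex.norm_exp]
      simp)
    (by
      intro i hi1 hi
      rw [iteratedFDerivWithin_of_isOpen _ isOpen_punctured hmem, hfd, mul_pow]
      have h1 : z * L ≤ (1 + z * L) ^ i := by
        have : 0 ≤ z * L := by positivity
        calc z * L ≤ 1 + z * L := by linarith
          _ ≤ (1 + z * L) ^ i := le_self_pow₀ (by linarith) (by omega)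
      calc z * ‖iteratedFDeriv ℝ i l ξ‖ ≤ z * (L * D ^ i) := by
            gcongr; exact hl i (hi.trans hn)
        _ = (z * L) * D ^ i := by ring
        _ ≤ _ := by gcongr)
  rw [iteratedFDerivWithin_of_isOpen _ isOpen_punctured hmem] at key
  refine key.trans ?_
  have : ((n.factorial : ℕ) : ℝ) ≤ 6 := by
    have := Nat.factorial_le hn
    exact_mod_cast this
  gcongr

theorem norm_iteratedFDeriv_comp_smul {F : Type*} [NormedAddCommGroup F] [NormedSpace ℝ F]
    {f : Plane → F} {c : ℝ} (hc : c ≠ 0) (ξ : Plane) (i : ℕ) :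
    ‖iteratedFDeriv ℝ i (fun η => f (c • η)) ξ‖ = |c| ^ i * ‖iteratedFDeriv ℝ i f (c • ξ)‖ := by
  have h := (ContinuousLinearEquiv.smulLeft (M₁ := Plane) (R₁ := ℝ)
    (Units.mk0 c hc)).iteratedFDerivWithin_comp_right f
    (s := Set.univ) uniqueDiffOn_univ (x := ξ) (Set.mem_univ _) i
  simp only [Set.preimage_univ, iteratedFDerivWithin_univ] at h
  have h2 : iteratedFDeriv ℝ i (fun η => f (c • η)) ξ = c ^ i • iteratedFDeriv ℝ i f (c • ξ) := by
    refine Eq.trans h ?_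
    ext m
    have := (iteratedFDeriv ℝ i f (c • ξ)).map_smul_univ (fun _ => c) m
    simpa using this
  rw [h2, norm_smul, norm_pow, Real.norm_eq_abs]

/-- Since only orders `i ≤ 3` occur, a factor `M ≥ 1` in the rate costs at most `M ^ 3` in the
amplitude. -/
theorem SymbolBoundAt.absorb {f : Plane → ℂ} {ξ : Plane} {A M D : ℝ}
    (h : SymbolBoundAt f ξ A (M * D)) (hA : 0 ≤ A) (hM : 1 ≤ M) (hD : 0 ≤ D) :
    SymbolBoundAt f ξ (A * M ^ 3) D := fun i hi => by
  refine (h i hi).trans ?_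
  rw [mul_pow, mul_assoc]
  gcongr

/-- `f` is smooth off the origin and satisfies symbol bounds of order `a` on `S`. -/
def IsSymbolOn (f : Plane → ℂ) (S : Set Plane) (a : ℝ) : Prop :=
  ContDiffOn ℝ ∞ f {0}ᶜ ∧
    ∃ C : ℝ, 0 ≤ C ∧ ∀ ξ ∈ S, ξ ≠ 0 → SymbolBoundAt f ξ (C * ‖ξ‖ ^ a) ‖ξ‖⁻¹

theorem IsSymbolOn.mono {f : Plane → ℂ} {S T : Set Plane} {a : ℝ} (hf : IsSymbolOn f S a)
    (hT : T ⊆ S) : IsSymbolOn f T a :=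
  ⟨hf.1, hf.2.imp fun _ h => ⟨h.1, fun ξ hξ => h.2 ξ (hT hξ)⟩⟩

theorem IsSymbolOn.union {f : Plane → ℂ} {S T : Set Plane} {a : ℝ} (hS : IsSymbolOn f S a)
    (hT : IsSymbolOn f T a) : IsSymbolOn f (S ∪ T) a := by
  obtain ⟨hf, C, hC, h⟩ := hS
  obtain ⟨-, D, hD, k⟩ := hT
  refine ⟨hf, max C D, hC.trans (le_max_left _ _), ?_⟩
  have hM : 0 ≤ max C D := hC.trans (le_max_left _ _)
  rintro ξ (hξ | hξ) h0
  · exact (h ξ hξ h0).mono (by gcongr; exact le_max_left _ _) (by positivity) (by positivity) le_rfl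
  · exact (k ξ hξ h0).mono (by gcongr; exact le_max_right _ _) (by positivity) (by positivity) le_rfl

theorem IsSymbolOn.mul {f g : Plane → ℂ} {S : Set Plane} {a b : ℝ} (hf : IsSymbolOn f S a)
    (hg : IsSymbolOn g S b) : IsSymbolOn (fun ξ => f ξ * g ξ) S (a + b) := by
  obtain ⟨hf, C, hC, h⟩ := hf
  obtain ⟨hg, D, hD, k⟩ := hg
  refine ⟨hf.mul hg, C * D * 2 ^ 3, by positivity, fun ξ hξ h0 => ?_⟩
  have := (h ξ hξ h0).mul (k ξ hξ h0) hf hg h0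
  rw [← two_mul] at this
  have h3 := this.absorb (by positivity) (by norm_num) (by positivity)
  refine h3.mono (le_of_eq ?_) (by positivity) (by positivity) le_rfl
  rw [Real.rpow_add (norm_pos_iff.2 h0)]
  ring

theorem IsSymbolOn.congr {f g : Plane → ℂ} {S : Set Plane} {a : ℝ} (hf : IsSymbolOn f S a)
    (hg : ContDiffOn ℝ ∞ g {0}ᶜ) (hfg : ∀ ξ ∈ S, ξ ≠ 0 → f =ᶠ[𝓝 ξ] g) : IsSymbolOn g S a := by
  obtain ⟨hf, C, hC, h⟩ := hf
  exact ⟨hg, C, hC, fun ξ hξ h0 => (h ξ hξ h0).congr (hfg ξ hξ h0)⟩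

theorem exists_norm_iteratedFDeriv_le {f : Plane → ℂ} {U K : Set Plane} (hf : ContDiffOn ℝ ∞ f U)
    (hU : IsOpen U) (hK : IsCompact K) (hKU : K ⊆ U) :
    ∃ C : ℝ, 0 ≤ C ∧ ∀ ξ ∈ K, ∀ i ≤ 3, ‖iteratedFDeriv ℝ i f ξ‖ ≤ C := by
  have hc : ∀ i : ℕ, ∃ C : ℝ, 0 ≤ C ∧ ∀ ξ ∈ K, ‖iteratedFDeriv ℝ i f ξ‖ ≤ C := by
    intro i
    have h1 : ContinuousOn (iteratedFDeriv ℝ i f) K := by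
      refine ((hf.continuousOn_iteratedFDerivWithin (m := i) (by exact_mod_cast le_top)
        hU.uniqueDiffOn).mono hKU).congr fun ξ hξ => ?_
      rw [iteratedFDerivWithin_of_isOpen _ hU (hKU hξ)]
    obtain ⟨C, hC⟩ := hK.exists_bound_of_continuousOn h1
    exact ⟨max C 0, le_max_right _ _, fun ξ hξ => (hC ξ hξ).trans (le_max_left _ _)⟩
  choose C hC0 hC using hc
  refine ⟨∑ i ∈ Finset.range 4, C i, Finset.sum_nonneg fun i _ => hC0 i, fun ξ hξ i hi => ?_⟩
  exact (hC i ξ hξ).trans (Finset.single_le_sum (f := C) (fun j _ => hC0 j)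
    (Finset.mem_range.2 (by omega)))

/-- On a bounded ball `‖ξ‖⁻¹` is bounded below, so constant bounds on the derivatives are stronger
than bounds by powers of `‖ξ‖⁻¹`. -/
theorem isSymbolOn_zero_of_contDiff {f : Plane → ℂ} (hf : ContDiff ℝ ∞ f) (R : ℝ) :
    IsSymbolOn f (Metric.closedBall 0 R) 0 := by
  obtain ⟨C, hC, h⟩ := exists_norm_iteratedFDeriv_le hf.contDiffOn isOpen_univ
    (isCompact_closedBall (0 : Plane) R) (Set.subset_univ _)
  refine ⟨hf.contDiffOn, C * (max R 1) ^ 3, by positivity, fun ξ hξ h0 => ?_⟩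
  have hξ' : ‖ξ‖ ≤ R := by simpa using hξ
  have hpos := norm_pos_iff.2 h0
  have : SymbolBoundAt f ξ C (max R 1 * ‖ξ‖⁻¹) := fun i hi => by
    refine (h ξ hξ i hi).trans (le_mul_of_one_le_right hC (one_le_pow₀ ?_))
    rw [← div_eq_mul_inv, one_le_div hpos]
    exact hξ'.trans (le_max_left _ _)
  simpa using this.absorb hC (le_max_right _ _) (by positivity)

/-- Away from the origin all powers of `‖ξ‖` are comparable on a compact set, so the order is
arbitrary. -/
theorem isSymbolOn_of_compact {f : Plane → ℂ} (hf : ContDiffOn ℝ ∞ f {0}ᶜ) {K : Set Plane}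
    (hK : IsCompact K) (h0 : (0 : Plane) ∉ K) (a : ℝ) : IsSymbolOn f K a := by
  have hK0 : K ⊆ {0}ᶜ := fun x hx => by rintro rfl; exact h0 hx
  obtain ⟨C, hC, h⟩ := exists_norm_iteratedFDeriv_le hf isOpen_punctured hK hK0
  have hc : ∀ i : ℕ, ∃ B : ℝ, 0 ≤ B ∧ ∀ ξ ∈ K, (‖ξ‖ ^ a * ‖ξ‖⁻¹ ^ i)⁻¹ ≤ B := by
    intro i
    have h1 : ContinuousOn (fun ξ : Plane => (‖ξ‖ ^ a * ‖ξ‖⁻¹ ^ i)⁻¹) K := by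
      intro ξ hξ
      have hp := norm_pos_iff.2 (hK0 hξ)
      refine ContinuousAt.continuousWithinAt ?_
      refine ContinuousAt.inv₀ (ContinuousAt.mul (continuous_norm.continuousAt.rpow_const
        (Or.inl hp.ne')) ((continuous_norm.continuousAt.inv₀ hp.ne').pow i)) (by positivity)
    obtain ⟨B, hB⟩ := hK.exists_bound_of_continuousOn h1
    exact ⟨max B 0, le_max_right _ _, fun ξ hξ =>
      ((le_abs_self _).trans (hB ξ hξ)).trans (le_max_left _ _)⟩
  choose B hB0 hB using hc
  refine ⟨hf, C * ∑ i ∈ Finset.range 4, B i,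
    mul_nonneg hC (Finset.sum_nonneg fun i _ => hB0 i), fun ξ hξ hne i hi => ?_⟩
  have hp := norm_pos_iff.2 hne
  have h2 : (‖ξ‖ ^ a * ‖ξ‖⁻¹ ^ i)⁻¹ ≤ ∑ i ∈ Finset.range 4, B i :=
    (hB i ξ hξ).trans (Finset.single_le_sum (f := B) (fun j _ => hB0 j)
      (Finset.mem_range.2 (by omega)))
  have hq : 0 < ‖ξ‖ ^ a * ‖ξ‖⁻¹ ^ i := by positivity
  have h3 := (inv_le_iff_one_le_mul₀ hq).1 h2
  calc ‖iteratedFDeriv ℝ i f ξ‖ ≤ C := h ξ hξ i hi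
    _ ≤ C * ((∑ i ∈ Finset.range 4, B i) * (‖ξ‖ ^ a * ‖ξ‖⁻¹ ^ i)) := le_mul_of_one_le_right hC h3
    _ = _ := by ring

/-- The `i`-th derivative is homogeneous of degree `a - i`, so its bound on the unit sphere
propagates by scaling. -/
theorem isSymbolOn_of_homogeneous {h : Plane → ℂ} {a : ℝ} (hs : ContDiffOn ℝ ∞ h {0}ᶜ)
    (hh : ∀ t : ℝ, 0 < t → ∀ ξ, ξ ≠ 0 → h (t • ξ) = ((t ^ a : ℝ) : ℂ) * h ξ) :
    IsSymbolOn h Set.univ a := by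
  obtain ⟨C, hC, hb⟩ := exists_norm_iteratedFDeriv_le hs isOpen_punctured
    (isCompact_sphere (0 : Plane) 1) (fun x hx => by rintro rfl; simp at hx)
  refine ⟨hs, C, hC, fun ξ _ h0 i hi => ?_⟩
  have hp := norm_pos_iff.2 h0
  set r := ‖ξ‖ with hr
  have hne : r⁻¹ ≠ 0 := inv_ne_zero hp.ne'
  have hmem : r⁻¹ • ξ ∈ ({0}ᶜ : Set Plane) := smul_ne_zero hne h0
  have hev : h =ᶠ[𝓝 ξ] fun η => (r ^ a) • h (r⁻¹ • η) := by
    filter_upwards [isOpen_punctured.mem_nhds (show ξ ∈ ({0}ᶜ : Set Plane) from h0)] with η hη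
    rw [hh _ (inv_pos.2 hp) η hη, Real.inv_rpow hp.le, Complex.real_smul, ← mul_assoc,
      ← Complex.ofReal_mul, mul_inv_cancel₀ (by positivity)]
    simp
  have hcd : ContDiffAt ℝ i (fun η => h (r⁻¹ • η)) ξ := by
    have h1 : ContDiffAt ℝ i h (r⁻¹ • ξ) :=
      (hs.contDiffAt (isOpen_punctured.mem_nhds hmem)).of_le (by exact_mod_cast le_top)
    exact h1.comp ξ (by fun_prop)
  rw [(hev.iteratedFDeriv ℝ i).eq_of_nhds, iteratedFDeriv_const_smul_apply' hcd, norm_smul,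
    norm_iteratedFDeriv_comp_smul hne, abs_of_pos (inv_pos.2 hp), Real.norm_of_nonneg (by positivity)]
  have := hb (r⁻¹ • ξ) (by simp [norm_smul, ← hr, abs_of_pos hp, hp.ne']) i hi
  calc r ^ a * (r⁻¹ ^ i * ‖iteratedFDeriv ℝ i h (r⁻¹ • ξ)‖) ≤ r ^ a * (r⁻¹ ^ i * C) := by gcongr
    _ = _ := by ring

/-! ### Symbol bounds for `χ P` and for its product with the exponential. -/

/-- From `1 + y ≤ e^y` with `y = c x / b`, the base is at most `(A + B b / c) e^(c x / b)`; the
power `b` of this gives exactly `e^(c x)`. -/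
theorem exists_rpow_mul_exp_neg_le {A B b c : ℝ} (hA : 0 ≤ A) (hB : 0 ≤ B) (hb : 0 ≤ b)
    (hc : 0 < c) : ∃ M : ℝ, 0 ≤ M ∧ ∀ x : ℝ, 0 ≤ x → (A + B * x) ^ b * Real.exp (-(c * x)) ≤ M := by
  rcases hb.eq_or_lt with rfl | hb
  · refine ⟨1, zero_le_one, fun x hx => ?_⟩
    simpa using mul_nonneg hc.le hx
  refine ⟨(A + B * b / c) ^ b, by positivity, fun x hx => ?_⟩
  have h1 : A + B * x ≤ (A + B * b / c) * Real.exp (c * x / b) := by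
    have h2 := Real.add_one_le_exp (c * x / b)
    have h3 : A + B * x ≤ (A + B * b / c) * (c * x / b + 1) := by
      have : (A + B * b / c) * (c * x / b + 1) = A + B * x + (A * (c * x / b) + B * b / c) := by
        field_simp
        ring
      rw [this]
      have : 0 ≤ A * (c * x / b) + B * b / c := by positivity
      linarith
    exact h3.trans (by gcongr)
  have h4 : (A + B * x) ^ b ≤ (A + B * b / c) ^ b * Real.exp (c * x) := by
    refine (Real.rpow_le_rpow (by positivity) h1 hb.le).trans (le_of_eq ?_)
    rw [Real.mul_rpow (by positivity) (by positivity), ← Real.exp_mul]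
    congr 2
    field_simp
  calc _ ≤ (A + B * b / c) ^ b * Real.exp (c * x) * Real.exp (-(c * x)) := by gcongr
    _ = _ := by rw [mul_assoc, ← Real.exp_add]; simp

theorem isSymbolOn_homogeneousPolynomial_mul_norm_rpow {k : ℕ} {p : MvPolynomial (Fin 2) ℂ}
    (hp : p.IsHomogeneous k) (α : ℝ) :
    IsSymbolOn (fun ξ : Plane =>
      MvPolynomial.eval (fun j => (ξ j : ℂ)) p * ((‖ξ‖ ^ (α - k) : ℝ) : ℂ)) Set.univ α := by
  refine isSymbolOn_of_homogeneous ?_ ?_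
  · refine ContDiffOn.mul ?_ ?_
    · refine ContDiff.contDiffOn ?_
      simp only [MvPolynomial.eval_eq]
      refine ContDiff.sum fun d _ => contDiff_const.mul (contDiff_prod fun j _ => ContDiff.pow ?_ _)
      exact Complex.ofRealCLM.contDiff.comp (by fun_prop)
    · refine Complex.ofRealCLM.contDiff.comp_contDiffOn ?_
      intro ξ hξ
      exact ((contDiffAt_norm ℝ hξ).rpow_const_of_ne (norm_ne_zero_iff.2 hξ)).contDiffWithinAt
  · intro t ht ξ hξ
    have h1 : MvPolynomial.eval (fun j => (((t • ξ) j : ℝ) : ℂ)) p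
        = (t : ℂ) ^ k * MvPolynomial.eval (fun j => (ξ j : ℂ)) p := by
      rw [MvPolynomial.eval_eq', MvPolynomial.eval_eq', Finset.mul_sum]
      refine Finset.sum_congr rfl fun d hd => ?_
      have hdk : ∑ i, d i = k := by
        have := hp (MvPolynomial.mem_support_iff.1 hd)
        rw [← Finsupp.degree_eq_sum, ← this]
        exact DFunLike.congr_fun Finsupp.degree_eq_weight_one d
      simp only [PiLp.smul_apply, smul_eq_mul, Complex.ofReal_mul, mul_pow,
        Finset.prod_mul_distrib, Finset.prod_pow_eq_pow_sum, hdk]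
      ring
    rw [h1, norm_smul, Real.norm_of_nonneg ht.le, Real.mul_rpow ht.le (norm_nonneg _),
      Complex.ofReal_mul]
    have h2 : (t : ℂ) ^ k * ((t ^ (α - k) : ℝ) : ℂ) = ((t ^ α : ℝ) : ℂ) := by
      rw [← Complex.ofReal_pow, ← Complex.ofReal_mul, ← Real.rpow_natCast, ← Real.rpow_add ht]
      congr 2; ring
    rw [← h2]; ring

/-- Three regions: a small ball where the factorization of `P` holds, a compact annulus where any
order is available, and the exterior where `χ` vanishes. -/
theorem isSymbolOn_cutoff_mul {χ P Q : Plane → ℂ} {k : ℕ} {p : MvPolynomial (Fin 2) ℂ} {α R : ℝ}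
    (hχ : ContDiff ℝ ∞ χ) (hR : ∀ ξ, R < ‖ξ‖ → χ ξ = 0)
    (hP : ContDiffOn ℝ ∞ P {0}ᶜ) (hp : p.IsHomogeneous k) (hQ : ContDiff ℝ ∞ Q)
    (hPQ : ∀ᶠ ξ : Plane in 𝓝[≠] 0,
      P ξ = MvPolynomial.eval (fun j => (ξ j : ℂ)) p * ((‖ξ‖ ^ (α - k) : ℝ) : ℂ) * Q ξ) :
    IsSymbolOn (fun ξ => χ ξ * P ξ) Set.univ α := by
  have hs : ContDiffOn ℝ ∞ (fun ξ => χ ξ * P ξ) {0}ᶜ := hχ.contDiffOn.mul hP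
  rw [eventually_nhdsWithin_iff, Metric.eventually_nhds_iff] at hPQ
  obtain ⟨r, hr, hPQ⟩ := hPQ
  have h1 : IsSymbolOn (fun ξ => χ ξ * P ξ) (Metric.ball 0 r) α := by
    have hm := ((isSymbolOn_zero_of_contDiff hχ r).mul
      (((isSymbolOn_homogeneousPolynomial_mul_norm_rpow hp α).mono
        (Set.subset_univ (Metric.closedBall 0 r))).mul (isSymbolOn_zero_of_contDiff hQ r)))
    rw [add_zero, zero_add] at hm
    refine (hm.mono Metric.ball_subset_closedBall).congr hs fun ξ hξ h0 => ?_
    filter_upwards [Metric.isOpen_ball.mem_nhds hξ,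
      isOpen_punctured.mem_nhds (show ξ ∈ ({0}ᶜ : Set Plane) from h0)] with η h1 h2
    rw [hPQ h1 h2]
  have h2 : IsSymbolOn (fun ξ => χ ξ * P ξ) (Metric.closedBall 0 R \ Metric.ball 0 r) α :=
    isSymbolOn_of_compact hs ((isCompact_closedBall _ _).diff Metric.isOpen_ball)
      (fun h => h.2 (Metric.mem_ball_self hr)) α
  have h3 : IsSymbolOn (fun ξ => χ ξ * P ξ) {ξ | R < ‖ξ‖} α := by
    have hz : IsSymbolOn (fun _ : Plane => (0 : ℂ)) {ξ | R < ‖ξ‖} α :=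
      ⟨contDiffOn_const, 0, le_rfl, fun ξ _ _ i _ => by
        have : iteratedFDeriv ℝ i (fun _ : Plane => (0 : ℂ)) = 0 := iteratedFDeriv_fun_zero
        simp [this]⟩
    refine hz.congr hs fun ξ hξ _ => ?_
    filter_upwards [(isOpen_lt continuous_const continuous_norm).mem_nhds hξ] with η hη
    rw [hR η hη, zero_mul]
  refine ((h1.union h2).union h3).mono fun ξ _ => ?_
  by_cases ha : ξ ∈ Metric.ball (0 : Plane) r
  · exact Or.inl (Or.inl ha)
  · by_cases hb : R < ‖ξ‖
    · exact Or.inr hb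
    · exact Or.inl (Or.inr ⟨by simpa using hb, ha⟩)

/-- Differentiating the exponential produces a factor `(2 + L x) ^ 3` with `x = z ‖ξ‖ ^ b`. Half of
the exponential decay absorbs it; the other half remains in the conclusion. -/
theorem exists_symbolBoundAt_mul_cexp {a l : Plane → ℂ} {α R b c : ℝ}
    (ha : IsSymbolOn a Set.univ α) (haR : ∀ ξ, R < ‖ξ‖ → a ξ = 0)
    (hl : IsSymbolOn l (Metric.closedBall 0 R) b) (hc : 0 < c)
    (hlre : ∀ ξ, ξ ≠ 0 → ‖ξ‖ ≤ R → c * ‖ξ‖ ^ b ≤ (l ξ).re) :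
    ∃ C : ℝ, 0 ≤ C ∧ ∀ z : ℝ, 0 ≤ z → ∀ ξ, ξ ≠ 0 →
      SymbolBoundAt (fun η => a η * Complex.exp (-(l η) * z)) ξ
        (C * ‖ξ‖ ^ α * Real.exp (-(c / 2 * (z * ‖ξ‖ ^ b)))) ‖ξ‖⁻¹ := by
  obtain ⟨has, A, hA, ha⟩ := ha
  obtain ⟨hls, L, hL, hl⟩ := hl
  obtain ⟨M, hM, hMb⟩ := exists_rpow_mul_exp_neg_le (A := 2) (B := L) (b := 3) (c := c / 2)
    (by norm_num) hL (by norm_num) (by positivity)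
  refine ⟨A * 6 * M, by positivity, fun z hz ξ h0 => ?_⟩
  by_cases hR : R < ‖ξ‖
  · have hz : (fun _ => 0) =ᶠ[𝓝 ξ] (fun η => a η * Complex.exp (-(l η) * z)) := by
      filter_upwards [(isOpen_lt continuous_const continuous_norm).mem_nhds hR] with η hη
      rw [haR η hη, zero_mul]
    refine SymbolBoundAt.congr (fun i _ => ?_) hz
    have : iteratedFDeriv ℝ i (fun _ : Plane => (0 : ℂ)) = 0 := iteratedFDeriv_fun_zero
    simp only [this, Pi.zero_apply, norm_zero]
    positivity
  · have hR' : ‖ξ‖ ≤ R := not_lt.1 hR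
    have hp := norm_pos_iff.2 h0
    have he := (hl ξ (by simpa using hR') h0).cexp_neg_mul hls h0 (by positivity) (by positivity) hz
    have hes : ContDiffOn ℝ ∞ (fun η => Complex.exp (-(l η) * z)) {0}ᶜ :=
      (hls.neg.mul contDiffOn_const).cexp
    have hm := (ha ξ trivial h0).mul he has hes h0
    set x := z * ‖ξ‖ ^ b with hx
    have hx0 : 0 ≤ x := by positivity
    have hD : ‖ξ‖⁻¹ + (1 + z * (L * ‖ξ‖ ^ b)) * ‖ξ‖⁻¹ = (2 + L * x) * ‖ξ‖⁻¹ := by rw [hx]; ring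
    rw [hD] at hm
    have hLx : 0 ≤ L * x := by positivity
    refine (hm.absorb (by positivity) (by linarith) (by positivity)).mono ?_ (by positivity)
      (by positivity) le_rfl
    have h1 : Real.exp (-((l ξ).re * z)) ≤ Real.exp (-(c / 2 * x)) * Real.exp (-(c / 2 * x)) := by
      rw [← Real.exp_add]
      refine Real.exp_le_exp.2 ?_
      have := mul_le_mul_of_nonneg_right (hlre ξ h0 hR') hz
      rw [hx]; linarith
    have h2 : (2 + L * x) ^ 3 * Real.exp (-(c / 2 * x)) ≤ M := by exact_mod_cast hMb x hx0
    calc A * ‖ξ‖ ^ α * (6 * Real.exp (-((l ξ).re * z))) * (2 + L * x) ^ 3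
        ≤ A * ‖ξ‖ ^ α * (6 * (Real.exp (-(c / 2 * x)) * Real.exp (-(c / 2 * x)))) *
          (2 + L * x) ^ 3 := by gcongr
      _ = A * ‖ξ‖ ^ α * 6 * Real.exp (-(c / 2 * x)) *
          ((2 + L * x) ^ 3 * Real.exp (-(c / 2 * x))) := by ring
      _ ≤ A * ‖ξ‖ ^ α * 6 * Real.exp (-(c / 2 * x)) * M := by gcongr
      _ = _ := by ring

/-! ### Closed formulas for the characteristic roots. -/

/-- The real root of `Y ^ 3 + Y + s = 0`. -/
noncomputable def depressedCubicRoot (s : ℝ) : ℝ :=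
  -(2 / √3) * Real.sinh (Real.arsinh (3 * √3 / 2 * s) / 3)

/-- Hyperbolic form of Cardano's formula: the substitution `Y = -(2/√3) sinh t` turns the cubic into
`sinh 3t = 4 sinh³ t + 3 sinh t`. Unlike the form with radicals, it is visibly smooth in `s`. -/
theorem depressedCubicRoot_spec (s : ℝ) :
    depressedCubicRoot s ^ 3 + depressedCubicRoot s + s = 0 := by
  have h3 : √3 ^ 2 = 3 := Real.sq_sqrt (by norm_num)
  have hpos : 0 < √3 := by positivity
  have h := Real.sinh_three_mul (Real.arsinh (3 * √3 / 2 * s) / 3)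
  rw [mul_div_cancel₀ _ (by norm_num : (3 : ℝ) ≠ 0), Real.sinh_arsinh] at h
  unfold depressedCubicRoot
  set w := Real.sinh (Real.arsinh (3 * √3 / 2 * s) / 3)
  have h4 : s = 2 / (3 * √3) * (4 * w ^ 3 + 3 * w) := by
    rw [← h]; field_simp
  rw [h4]
  field_simp
  rw [h3]
  ring

theorem contDiff_depressedCubicRoot : ContDiff ℝ ∞ depressedCubicRoot := by
  unfold depressedCubicRoot
  refine contDiff_const.mul (Real.contDiff_sinh.comp (ContDiff.div_const ?_ 3))
  exact Real.contDiff_arsinh.comp (contDiff_const.mul contDiff_id)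

/-- Extracts the factor `s = ‖ξ‖ ^ 2` from `Y`. As `λ₁² = Y + s = -Y ^ 3`, this exhibits `λ₁` as
`‖ξ‖ ^ 3` times a smooth positive factor. -/
theorem neg_depressedCubicRoot_eq (s : ℝ) :
    -depressedCubicRoot s = s * (1 + depressedCubicRoot s ^ 2)⁻¹ := by
  have := depressedCubicRoot_spec s
  have h : 0 < 1 + depressedCubicRoot s ^ 2 := by positivity
  rw [eq_mul_inv_iff_mul_eq₀ h.ne']
  linear_combination -this

/-- The smooth positive factor `λ₁(ξ) / |ξ| ^ 3`. -/
noncomputable def charRoot₁Factor (ξ : Plane) : ℝ :=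
  √(1 + depressedCubicRoot (‖ξ‖ ^ 2) ^ 2)⁻¹ ^ 3

theorem charRoot₁Factor_pos (ξ : Plane) : 0 < charRoot₁Factor ξ := by
  unfold charRoot₁Factor
  positivity

theorem contDiff_depressedCubicRoot_norm_sq :
    ContDiff ℝ ∞ fun ξ : Plane => depressedCubicRoot (‖ξ‖ ^ 2) :=
  contDiff_depressedCubicRoot.comp (contDiff_norm_sq ℝ)

theorem contDiff_charRoot₁Factor : ContDiff ℝ ∞ charRoot₁Factor := by
  have hp : ∀ ξ : Plane, 0 < 1 + depressedCubicRoot (‖ξ‖ ^ 2) ^ 2 := fun ξ => by positivity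
  refine ContDiff.pow (ContDiff.sqrt (ContDiff.inv ?_ fun ξ => (hp ξ).ne')
    fun ξ => (inv_pos.2 (hp ξ)).ne') 3
  exact contDiff_const.add (contDiff_depressedCubicRoot_norm_sq.pow 2)

theorem charRoot₁_eq (ξ : Plane) : charRoot₁ ξ = ((‖ξ‖ ^ (3 : ℝ) * charRoot₁Factor ξ : ℝ) : ℂ) := by
  unfold charRoot₁
  congr 1
  refine (existsUnique_charRoot₁ ξ).unique (existsUnique_charRoot₁ ξ).choose_spec.1 ?_
  refine ⟨mul_nonneg (by positivity) (charRoot₁Factor_pos ξ).le, ?_⟩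
  rw [isCharRoot_ofReal_iff]
  have h1 := depressedCubicRoot_spec (‖ξ‖ ^ 2)
  have h2 := neg_depressedCubicRoot_eq (‖ξ‖ ^ 2)
  unfold charRoot₁Factor
  set Y := depressedCubicRoot (‖ξ‖ ^ 2)
  have hs : √(1 + Y ^ 2)⁻¹ ^ 2 = (1 + Y ^ 2)⁻¹ := Real.sq_sqrt (by positivity)
  have h3 : (‖ξ‖ ^ (3 : ℝ) * √(1 + Y ^ 2)⁻¹ ^ 3) ^ 2 = -Y ^ 3 := by
    have : (‖ξ‖ ^ (3 : ℝ)) = ‖ξ‖ ^ 3 := by exact_mod_cast Real.rpow_natCast ‖ξ‖ 3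
    calc (‖ξ‖ ^ (3 : ℝ) * √(1 + Y ^ 2)⁻¹ ^ 3) ^ 2
        = (‖ξ‖ ^ 2 * (√(1 + Y ^ 2)⁻¹ ^ 2)) ^ 3 := by rw [this]; ring
      _ = -Y ^ 3 := by rw [hs, ← h2]; ring
  rw [h3]
  have h4 : -Y ^ 3 - ‖ξ‖ ^ 2 = Y := by linear_combination -h1
  rw [h4]; ring

theorem isSymbolOn_charRoot₁ (R : ℝ) : IsSymbolOn charRoot₁ (Metric.closedBall 0 R) 3 := by
  have h1 : IsSymbolOn (fun ξ : Plane => ((‖ξ‖ ^ (3 : ℝ) : ℝ) : ℂ)) Set.univ 3 := by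
    refine isSymbolOn_of_homogeneous ?_ fun t ht ξ _ => ?_
    · refine Complex.ofRealCLM.contDiff.comp_contDiffOn fun ξ hξ => ?_
      exact ((contDiffAt_norm ℝ hξ).rpow_const_of_ne (norm_ne_zero_iff.2 hξ)).contDiffWithinAt
    · rw [norm_smul, Real.norm_of_nonneg ht.le, Real.mul_rpow ht.le (norm_nonneg _),
        Complex.ofReal_mul]
  have h2 := isSymbolOn_zero_of_contDiff
    (f := fun ξ => (charRoot₁Factor ξ : ℂ)) (Complex.ofRealCLM.contDiff.comp contDiff_charRoot₁Factor) R
  have h3 := (h1.mono (Set.subset_univ (Metric.closedBall 0 R))).mul h2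
  rw [add_zero] at h3
  have h4 : charRoot₁ = fun ξ : Plane => ((‖ξ‖ ^ (3 : ℝ) : ℝ) : ℂ) * (charRoot₁Factor ξ : ℂ) := by
    ext ξ; rw [charRoot₁_eq, Complex.ofReal_mul]
  rwa [h4]

theorem exists_le_charRoot₁_re (R : ℝ) :
    ∃ c : ℝ, 0 < c ∧ ∀ ξ : Plane, ‖ξ‖ ≤ R → c * ‖ξ‖ ^ (3 : ℝ) ≤ (charRoot₁ ξ).re := by
  rcases lt_or_ge R 0 with hR | hR
  · exact ⟨1, one_pos, fun ξ hξ => absurd (hξ.trans_lt hR) (norm_nonneg ξ).not_gt⟩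
  obtain ⟨η, -, hη⟩ := (isCompact_closedBall (0 : Plane) R).exists_isMinOn
    ⟨0, Metric.mem_closedBall_self hR⟩ contDiff_charRoot₁Factor.continuous.continuousOn
  refine ⟨charRoot₁Factor η, charRoot₁Factor_pos η, fun ξ hξ => ?_⟩
  rw [charRoot₁_eq, Complex.ofReal_re, mul_comm]
  exact mul_le_mul_of_nonneg_left (hη (by simpa using hξ)) (by positivity)

/-- The square of `λ₂(ξ)`. -/
noncomputable def charRoot₂Sq (ξ : Plane) : ℂ :=
  ((‖ξ‖ ^ 2 - depressedCubicRoot (‖ξ‖ ^ 2) / 2 : ℝ) : ℂ) +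
    ((√(3 * depressedCubicRoot (‖ξ‖ ^ 2) ^ 2 + 4) / 2 : ℝ) : ℂ) * Complex.I

/-- Keeps `charRoot₂Sq` off the branch cut of the logarithm, so that its square root is smooth on
the whole plane, the origin included. -/
theorem charRoot₂Sq_im_pos (ξ : Plane) : 0 < (charRoot₂Sq ξ).im := by
  have : (charRoot₂Sq ξ).im = √(3 * depressedCubicRoot (‖ξ‖ ^ 2) ^ 2 + 4) / 2 := by
    simp [charRoot₂Sq, -Complex.ofReal_pow]
  rw [this]
  positivity

theorem contDiff_charRoot₂Sq : ContDiff ℝ ∞ charRoot₂Sq := by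
  have hY := contDiff_depressedCubicRoot_norm_sq
  refine (Complex.ofRealCLM.contDiff.comp ?_).add
    ((Complex.ofRealCLM.contDiff.comp ?_).mul contDiff_const)
  · exact (contDiff_norm_sq ℝ).sub (hY.div_const 2)
  · refine ContDiff.div_const (ContDiff.sqrt ?_ fun ξ => by positivity) 2
    exact (contDiff_const.mul (hY.pow 2)).add contDiff_const

/-- The argument of `charRoot₂Sq` lies in `(0, π)`, so halving it lands in the open first quadrant,
where the characteristic root is unique. -/
theorem charRoot₂_eq (ξ : Plane) : charRoot₂ ξ = Complex.exp (Complex.log (charRoot₂Sq ξ) / 2) := by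
  refine (existsUnique_charRoot₂ ξ).unique (existsUnique_charRoot₂ ξ).choose_spec.1 ?_
  have him := charRoot₂Sq_im_pos ξ
  have hne : charRoot₂Sq ξ ≠ 0 := fun h => by simp [h] at him
  constructor
  · have h0 : 0 < (charRoot₂Sq ξ).arg := by
      refine lt_of_le_of_ne (Complex.arg_nonneg_iff.2 him.le) fun h => ?_
      have := (Complex.arg_eq_zero_iff.1 h.symm).2
      exact him.ne' this
    have h1 := Complex.arg_le_pi (charRoot₂Sq ξ)
    have h2 : (Complex.log (charRoot₂Sq ξ) / 2).im = (charRoot₂Sq ξ).arg / 2 := by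
      rw [show (2 : ℂ) = ((2 : ℝ) : ℂ) by norm_num, Complex.div_ofReal_im, Complex.log_im]
    have h3 : (charRoot₂Sq ξ).arg ≠ Real.pi := fun h => by
      have := (Complex.arg_eq_pi_iff.1 h).2
      exact him.ne' this
    have h4 := lt_of_le_of_ne h1 h3
    rw [Complex.exp_re, Complex.exp_im, h2]
    refine ⟨mul_pos (Real.exp_pos _) (Real.cos_pos_of_mem_Ioo ⟨by linarith, by linarith⟩),
      mul_pos (Real.exp_pos _) (Real.sin_pos_of_pos_of_lt_pi (by linarith) (by linarith))⟩
  · rw [isCharRoot_iff, ← Complex.exp_nat_mul, Nat.cast_ofNat, mul_div_cancel₀ _ two_ne_zero,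
      Complex.exp_log hne]
    have hY0 := depressedCubicRoot_spec (‖ξ‖ ^ 2)
    unfold charRoot₂Sq
    generalize depressedCubicRoot (‖ξ‖ ^ 2) = Y₀ at hY0
    have hd0 : √(3 * Y₀ ^ 2 + 4) ^ 2 = 3 * Y₀ ^ 2 + 4 := Real.sq_sqrt (by positivity)
    generalize √(3 * Y₀ ^ 2 + 4) = d₀ at hd0
    have hY : (Y₀ : ℂ) ^ 3 + Y₀ + (‖ξ‖ : ℂ) ^ 2 = 0 := by
      rw [← Complex.ofReal_zero, ← hY0]
      push_cast
      ring
    have hd : (d₀ : ℂ) ^ 2 = 3 * (Y₀ : ℂ) ^ 2 + 4 := by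
      rw [← Complex.ofReal_pow, hd0]
      push_cast
      ring
    push_cast
    generalize (Y₀ : ℂ) = Y at hY hd
    generalize (d₀ : ℂ) = d at hd
    -- The cubic factors as `(y - Y) (y² + Y y + Y² + 1)` with `Y` its real root; this `y` is the
    -- root of the quadratic factor in the upper half-plane.
    set y : ℂ := -Y / 2 + d / 2 * Complex.I with hy
    have hyq : y ^ 2 + Y * y + (Y ^ 2 + 1) = 0 := by
      rw [hy]
      linear_combination d ^ 2 / 4 * Complex.I_sq - hd / 4
    have hyc : y ^ 3 + y + (‖ξ‖ : ℂ) ^ 2 = 0 := by linear_combination (y - Y) * hyq + hY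
    have h5 : (‖ξ‖ : ℂ) ^ 2 - Y / 2 + d / 2 * Complex.I = (‖ξ‖ : ℂ) ^ 2 + y := by rw [hy]; ring
    rw [h5]
    linear_combination -hyc

theorem contDiff_charRoot₂ : ContDiff ℝ ∞ charRoot₂ := by
  have h : charRoot₂ = fun ξ => Complex.exp (Complex.log (charRoot₂Sq ξ) / 2) := funext charRoot₂_eq
  rw [h]
  refine ContDiff.cexp (ContDiff.div_const ?_ 2)
  rw [contDiff_iff_contDiffAt]
  intro ξ
  have := (Complex.contDiffAt_log (n := ∞) (x := charRoot₂Sq ξ)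
    (Or.inr (charRoot₂Sq_im_pos ξ).ne')).restrict_scalars ℝ
  exact this.comp ξ contDiff_charRoot₂Sq.contDiffAt

theorem contDiff_charRoot₃ : ContDiff ℝ ∞ charRoot₃ :=
  Complex.conjCLE.contDiff.comp contDiff_charRoot₂

theorem charRoot₃_re (ξ : Plane) : (charRoot₃ ξ).re = (charRoot₂ ξ).re := Complex.conj_re _

theorem exists_le_charRoot₂_re (R : ℝ) :
    ∃ c : ℝ, 0 < c ∧ ∀ ξ : Plane, ‖ξ‖ ≤ R → c ≤ (charRoot₂ ξ).re := by
  rcases lt_or_ge R 0 with hR | hR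
  · exact ⟨1, one_pos, fun ξ hξ => absurd (hξ.trans_lt hR) (norm_nonneg ξ).not_gt⟩
  obtain ⟨η, -, hη⟩ := (isCompact_closedBall (0 : Plane) R).exists_isMinOn
    ⟨0, Metric.mem_closedBall_self hR⟩
    (Complex.continuous_re.comp contDiff_charRoot₂.continuous).continuousOn
  exact ⟨_, (existsUnique_charRoot₂ η).choose_spec.1.1.1, fun ξ hξ => hη (by simpa using hξ)⟩

/-! ### Fourier inversion and decay of kernels. -/

section

open scoped FourierTransform

theorem aestronglyMeasurable_of_continuousOn_punctured {F : Type*} [NormedAddCommGroup F]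
    {f : Plane → F} (hf : ContinuousOn f {0}ᶜ) : AEStronglyMeasurable f volume := by
  have h := hf.aestronglyMeasurable (μ := volume) (measurableSet_singleton (0 : Plane)).compl
  rwa [restrict_compl_singleton] at h

theorem ae_ne_zero_plane : ∀ᵐ ξ : Plane, ξ ≠ 0 := by
  simp [ae_iff]

theorem integrable_one_add_mul_norm_rpow {b L : ℝ} (hb : 2 < b) (hL : 0 < L) :
    Integrable (fun ξ : Plane => (1 + L * ‖ξ‖) ^ (-b)) := by
  have h := integrable_one_add_norm (E := Plane) (μ := volume) (r := b) (by simpa using hb)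
  have h2 := (integrable_comp_smul_iff volume (fun ξ : Plane => (1 + ‖ξ‖) ^ (-b)) hL.ne').2 h
  simpa [norm_smul, abs_of_pos hL] using h2

theorem integral_one_add_mul_norm_rpow (b : ℝ) {L : ℝ} (hL : 0 < L) :
    ∫ ξ : Plane, (1 + L * ‖ξ‖) ^ (-b) = (L ^ 2)⁻¹ * ∫ ξ : Plane, (1 + ‖ξ‖) ^ (-b) := by
  have h := Measure.integral_comp_smul volume (fun ξ : Plane => (1 + ‖ξ‖) ^ (-b)) L
  simpa [norm_smul, abs_of_pos hL] using h

theorem norm_invFourier_const_le : ‖(1 / (2 * (Real.pi : ℂ)) ^ 2)‖ ≤ 1 := by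
  rw [norm_div, norm_one, norm_pow, norm_mul, Complex.norm_real, Complex.norm_two,
    Real.norm_of_nonneg Real.pi_pos.le]
  refine div_le_one_of_le₀ (one_le_pow₀ ?_) (by positivity)
  linarith [Real.two_le_pi]

theorem norm_invFourier_le_of_norm_le {m : Plane → ℂ} {g : Plane → ℝ} (hg : Integrable g)
    (hmg : ∀ ξ, ξ ≠ 0 → ‖m ξ‖ ≤ g ξ) (x : Plane) : ‖invFourier m x‖ ≤ ∫ ξ, g ξ := by
  have h1 : ‖∫ ξ : Plane, Complex.exp (Complex.I * (inner ℝ x ξ : ℝ)) * m ξ‖ ≤ ∫ ξ, g ξ := by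
    refine norm_integral_le_of_norm_le hg ?_
    filter_upwards [ae_ne_zero_plane] with ξ hξ
    rw [norm_mul, mul_comm Complex.I, Complex.norm_exp_ofReal_mul_I, one_mul]
    exact hmg ξ hξ
  unfold invFourier
  rw [norm_mul]
  calc _ ≤ 1 * ‖∫ ξ : Plane, Complex.exp (Complex.I * (inner ℝ x ξ : ℝ)) * m ξ‖ := by
        gcongr; exact norm_invFourier_const_le
    _ ≤ _ := by rwa [one_mul]

theorem invFourier_eq_fourier (m : Plane → ℂ) (x : Plane) :
    invFourier m x = (1 / (2 * (Real.pi : ℂ)) ^ 2) * 𝓕 m (-(2 * Real.pi)⁻¹ • x) := by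
  unfold invFourier
  rw [Real.fourier_eq']
  congr 2
  ext ξ
  rw [smul_eq_mul, real_inner_smul_right, real_inner_comm ξ x]
  congr 2
  have : -2 * Real.pi * (-(2 * Real.pi)⁻¹ * inner ℝ ξ x) = inner ℝ ξ x := by
    field_simp
  rw [this, mul_comm]

theorem norm_pow_mul_norm_fourier_le {f : Plane → ℂ} (hf : ContDiff ℝ ∞ f)
    (hc : HasCompactSupport f) (n : ℕ) (w : Plane) :
    (2 * Real.pi * ‖w‖) ^ n * ‖𝓕 f w‖ ≤ ∫ ξ, ‖iteratedFDeriv ℝ n f ξ‖ := by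
  have hint : ∀ i : ℕ, (i : ℕ∞) ≤ ⊤ → Integrable (iteratedFDeriv ℝ i f) := fun i _ =>
    (hf.continuous_iteratedFDeriv (by exact_mod_cast le_top)).integrable_of_hasCompactSupport
      (hc.iteratedFDeriv i)
  have h := congrFun (Real.fourier_iteratedFDeriv (N := ⊤) hf hint (n := n) le_top) w
  have h1 : ‖𝓕 (iteratedFDeriv ℝ n f) w‖ ≤ ∫ ξ, ‖iteratedFDeriv ℝ n f ξ‖ :=
    VectorFourier.norm_fourierIntegral_le_integral_norm _ _ _ _ _
  rcases eq_or_ne w 0 with rfl | hw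
  · rcases Nat.eq_zero_or_pos n with rfl | hn
    · simp only [pow_zero, one_mul, norm_iteratedFDeriv_zero]
      exact VectorFourier.norm_fourierIntegral_le_integral_norm _ _ _ _ _
    · rw [norm_zero, mul_zero, zero_pow hn.ne', zero_mul]
      positivity
  have hw' := norm_pos_iff.2 hw
  -- Testing the multilinear form on `n` copies of `w` gives `(2π ‖w‖²) ^ n ‖𝓕 f w‖` on the left and
  -- a factor `‖w‖ ^ n` on the right, which is cancelled at the end.
  have h2 := (𝓕 (iteratedFDeriv ℝ n f) w).le_opNorm (fun _ => w)
  rw [h] at h2 h1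
  have h3 := h2.trans (mul_le_mul_of_nonneg_right h1 (by positivity))
  simp only [VectorFourier.fourierPowSMulRight_apply, Finset.prod_const, Finset.card_univ,
    Fintype.card_fin, norm_smul, norm_pow, norm_neg, norm_mul, Complex.norm_I,
    neg_apply] at h3
  simp only [Complex.norm_two, Complex.norm_real, Real.norm_of_nonneg Real.pi_pos.le,
    mul_one] at h3
  have hn : ‖innerSL ℝ w w‖ = ‖w‖ ^ 2 := by
    rw [innerSL_apply_apply, real_inner_self_eq_norm_sq, norm_pow, norm_norm]
  rw [hn] at h3
  refine le_of_mul_le_mul_right ?_ (pow_pos hw' n)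
  refine le_trans (le_of_eq ?_) h3
  ring

theorem norm_pow_mul_norm_invFourier_le {f : Plane → ℂ} (hf : ContDiff ℝ ∞ f)
    (hc : HasCompactSupport f) (n : ℕ) (x : Plane) :
    ‖x‖ ^ n * ‖invFourier f x‖ ≤ ∫ ξ, ‖iteratedFDeriv ℝ n f ξ‖ := by
  have h := norm_pow_mul_norm_fourier_le hf hc n (-(2 * Real.pi)⁻¹ • x)
  have h3 : 2 * Real.pi * ‖-(2 * Real.pi)⁻¹ • x‖ = ‖x‖ := by
    rw [norm_smul, norm_neg, norm_inv, Real.norm_of_nonneg (by positivity)]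
    field_simp
  rw [h3] at h
  rw [invFourier_eq_fourier, norm_mul]
  refine le_trans ?_ h
  gcongr
  exact mul_le_of_le_one_left (norm_nonneg _) norm_invFourier_const_le

/-- A smooth function that vanishes near the origin and equals one away from it. -/
theorem exists_highPass : ∃ ψ : Plane → ℂ, ContDiff ℝ ∞ ψ ∧ (∀ ξ, ‖ξ‖ < 1 → ψ ξ = 0) ∧
    (∀ ξ, 2 < ‖ξ‖ → ψ ξ = 1) ∧ (∀ ξ, ‖1 - ψ ξ‖ ≤ 1) ∧ IsSymbolOn ψ Set.univ 0 := by
  let φ : ContDiffBump (0 : Plane) := ⟨1, 2, one_pos, one_lt_two⟩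
  have hs : ContDiff ℝ ∞ (fun ξ => ((1 - φ ξ : ℝ) : ℂ)) :=
    Complex.ofRealCLM.contDiff.comp (contDiff_const.sub φ.contDiff)
  have h2 : ∀ ξ : Plane, 2 < ‖ξ‖ → ((1 - φ ξ : ℝ) : ℂ) = 1 := fun ξ hξ => by
    rw [φ.zero_of_le_dist (by simpa using hξ.le)]; simp
  refine ⟨fun ξ => ((1 - φ ξ : ℝ) : ℂ), hs, fun ξ hξ => ?_, h2, fun ξ => ?_, ?_⟩
  · simp only [φ.one_of_mem_closedBall (x := ξ) (by simpa using hξ.le), sub_self,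
      Complex.ofReal_zero]
  · have : (1 : ℂ) - ((1 - φ ξ : ℝ) : ℂ) = ((φ ξ : ℝ) : ℂ) := by push_cast; ring
    rw [this, Complex.norm_real, Real.norm_of_nonneg φ.nonneg]
    exact φ.le_one
  · have h1 := isSymbolOn_zero_of_contDiff hs 2
    have hone : IsSymbolOn (fun _ : Plane => (1 : ℂ)) {ξ | 2 < ‖ξ‖} 0 :=
      (isSymbolOn_of_homogeneous contDiffOn_const (by simp)).mono (Set.subset_univ _)
    refine (h1.union (hone.congr hs.contDiffOn fun ξ hξ _ => ?_)).mono fun ξ _ => ?_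
    · filter_upwards [(isOpen_lt continuous_const continuous_norm).mem_nhds hξ] with η hη
      exact (h2 η hη).symm
    · rcases le_or_gt ‖ξ‖ 2 with h | h
      · exact Or.inl (by simpa using h)
      · exact Or.inr h

theorem SymbolBoundAt.norm_le {f : Plane → ℂ} {ξ : Plane} {A D : ℝ} (h : SymbolBoundAt f ξ A D) :
    ‖f ξ‖ ≤ A := by simpa using h 0 (by norm_num)

theorem integrable_of_bounded_of_vanishing {m : Plane → ℂ} {B R : ℝ}
    (hm : ContinuousOn m {0}ᶜ) (hB : ∀ ξ, ξ ≠ 0 → ‖ξ‖ ≤ R → ‖m ξ‖ ≤ B)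
    (hR : ∀ ξ, R < ‖ξ‖ → m ξ = 0) : Integrable m := by
  have hg : Integrable ((Metric.closedBall (0 : Plane) R).indicator fun _ => B) :=
    (integrable_indicator_iff measurableSet_closedBall).2
      (integrableOn_const (isCompact_closedBall _ _).measure_lt_top.ne)
  refine hg.mono' (aestronglyMeasurable_of_continuousOn_punctured hm) ?_
  filter_upwards [ae_ne_zero_plane] with ξ h0
  by_cases h : ‖ξ‖ ≤ R
  · rw [Set.indicator_of_mem (by simpa using h)]
    exact hB ξ h0 h
  · rw [Set.indicator_of_notMem (by simpa using h), hR ξ (not_le.1 h), norm_zero]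

theorem invFourier_add {f g : Plane → ℂ} (hf : Integrable f) (hg : Integrable g) (x : Plane) :
    invFourier (fun ξ => f ξ + g ξ) x = invFourier f x + invFourier g x := by
  have h : ∀ {f : Plane → ℂ}, Integrable f →
      Integrable fun ξ : Plane => Complex.exp (Complex.I * (inner ℝ x ξ : ℝ)) * f ξ := by
    intro f hf
    refine hf.bdd_mul (c := 1) (by fun_prop) (ae_of_all _ fun ξ => ?_)
    rw [mul_comm Complex.I, Complex.norm_exp_ofReal_mul_I]
  unfold invFourier
  simp only [mul_add]
  rw [integral_add (h hf) (h hg), mul_add]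

theorem SymbolBoundAt.comp_smul {f : Plane → ℂ} {ξ : Plane} {A D c : ℝ}
    (h : SymbolBoundAt f (c • ξ) A D) (hc : 0 < c) :
    SymbolBoundAt (fun η => f (c • η)) ξ A (c * D) := fun i hi => by
  rw [norm_iteratedFDeriv_comp_smul hc.ne', abs_of_pos hc, mul_pow, mul_left_comm]
  have := h i hi
  gcongr

/-- Decay of the inverse Fourier transform of a compactly supported symbol of order `ε`. -/
theorem exists_norm_invFourier_le {ε : ℝ} (hε : 0 < ε) (hε1 : ε < 1) :
    ∃ C : ℝ, 0 ≤ C ∧ ∀ (m : Plane → ℂ) (A R : ℝ), 0 ≤ A → ContDiffOn ℝ ∞ m {0}ᶜ →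
      (∀ ξ, R < ‖ξ‖ → m ξ = 0) → (∀ ξ, ξ ≠ 0 → SymbolBoundAt m ξ (A * ‖ξ‖ ^ ε) ‖ξ‖⁻¹) →
      ∀ x, x ≠ 0 → ‖invFourier m x‖ ≤ C * A * ‖x‖ ^ (-2 - ε) := by
  obtain ⟨ψ, hψ, hψ0, hψ1, hψle, -, B, hB, hψs⟩ := exists_highPass
  set J₃ := ∫ ξ : Plane, (1 + ‖ξ‖) ^ (-3 : ℝ) with hJ₃
  set J := ∫ ξ : Plane, (1 + ‖ξ‖) ^ (-(3 - ε)) with hJ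
  have hJ₃0 : 0 ≤ J₃ := integral_nonneg fun ξ => by positivity
  have hJ0 : 0 ≤ J := integral_nonneg fun ξ => by positivity
  refine ⟨54 * J₃ + 64 * B * J, by positivity, fun m A R hA hm hR hs x hx => ?_⟩
  set ρ := ‖x‖ with hρdef
  have hρ : 0 < ρ := norm_pos_iff.2 hx
  have hψρ : ContDiff ℝ ∞ (fun ξ : Plane => ψ (ρ • ξ)) := hψ.comp (by fun_prop)
  -- Splitting at frequency `1 / ρ`: `m₁` is estimated by its size alone, while `m₂` vanishes near
  -- the origin and is therefore smooth, so integration by parts applies.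
  set m₁ : Plane → ℂ := fun ξ => (1 - ψ (ρ • ξ)) * m ξ with hm₁
  set m₂ : Plane → ℂ := fun ξ => ψ (ρ • ξ) * m ξ with hm₂
  have hnorm : ∀ ξ : Plane, ‖ρ • ξ‖ = ρ * ‖ξ‖ := fun ξ => by
    rw [norm_smul, Real.norm_of_nonneg hρ.le]
  have hmint : Integrable m := by
    refine integrable_of_bounded_of_vanishing (B := A * R ^ ε) hm.continuousOn
      (fun ξ h0 hξ => (hs ξ h0).norm_le.trans ?_) hR
    gcongr
  have hzero : ∀ ξ : Plane, ρ * ‖ξ‖ < 1 → m₂ =ᶠ[𝓝 ξ] fun _ => 0 := by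
    intro ξ hξ
    filter_upwards [(isOpen_lt (continuous_const.mul continuous_norm) continuous_const).mem_nhds
      (show ρ * ‖ξ‖ < 1 from hξ)] with η hη
    rw [hm₂]
    simp only [hψ0 (ρ • η) (by rw [hnorm]; exact hη), zero_mul]
  have hm₂s : ContDiff ℝ ∞ m₂ := by
    rw [contDiff_iff_contDiffAt]
    intro ξ
    rcases eq_or_ne ξ 0 with rfl | h0
    · exact contDiffAt_const.congr_of_eventuallyEq (hzero 0 (by simp))
    · exact hψρ.contDiffAt.mul (hm.contDiffAt (isOpen_punctured.mem_nhds h0))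
  have hm₂c : HasCompactSupport m₂ := by
    refine HasCompactSupport.intro (isCompact_closedBall (0 : Plane) R) fun ξ hξ => ?_
    rw [hm₂]
    simp only [hR ξ (by simpa using hξ), mul_zero]
  have hm₂int : Integrable m₂ := hm₂s.continuous.integrable_of_hasCompactSupport hm₂c
  have hm₁int : Integrable m₁ := by
    have : m₁ = m - m₂ := by ext ξ; simp only [hm₁, hm₂, Pi.sub_apply]; ring
    rw [this]
    exact hmint.sub hm₂int
  have hsplit : invFourier m x = invFourier m₁ x + invFourier m₂ x := by
    rw [← invFourier_add hm₁int hm₂int]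
    congr 1
    ext ξ
    simp only [hm₁, hm₂]; ring
  have hρε : ρ ^ (-ε) * (ρ ^ 2)⁻¹ = ρ ^ (-2 - ε) := by
    rw [← Real.rpow_natCast, ← Real.rpow_neg hρ.le, ← Real.rpow_add hρ]
    congr 1; push_cast; ring
  -- low frequencies
  have h1 : ‖invFourier m₁ x‖ ≤ 54 * J₃ * A * ρ ^ (-2 - ε) := by
    -- On the support of `m₁` one has `ρ ‖ξ‖ ≤ 2`, so `‖ξ‖ ^ ε ≤ 2 ρ ^ (-ε)` and the weight is at
    -- least `1 / 27`; hence `54 = 2 * 27`.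
    have hg := (integrable_one_add_mul_norm_rpow (b := 3) (by norm_num) hρ).const_mul
      (54 * A * ρ ^ (-ε))
    refine (norm_invFourier_le_of_norm_le hg (fun ξ h0 => ?_) x).trans (le_of_eq ?_)
    · rcases lt_or_ge 2 (ρ * ‖ξ‖) with h | h
      · simp only [hm₁, hψ1 (ρ • ξ) (by rwa [hnorm]), sub_self, zero_mul, norm_zero]
        positivity
      · have h3 : ‖m₁ ξ‖ ≤ A * ‖ξ‖ ^ ε := by
          simp only [hm₁, norm_mul]
          calc _ ≤ 1 * (A * ‖ξ‖ ^ ε) :=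
                mul_le_mul (hψle _) (hs ξ h0).norm_le (norm_nonneg _) zero_le_one
            _ = _ := one_mul _
        have h4 : ‖ξ‖ ^ ε ≤ 2 * ρ ^ (-ε) := by
          have h5 : ‖ξ‖ = (ρ * ‖ξ‖) * ρ⁻¹ := by field_simp
          rw [h5, Real.mul_rpow (by positivity) (by positivity), Real.inv_rpow hρ.le,
            ← Real.rpow_neg hρ.le]
          gcongr
          calc (ρ * ‖ξ‖) ^ ε ≤ 2 ^ ε := by gcongr
            _ ≤ 2 ^ (1 : ℝ) := Real.rpow_le_rpow_of_exponent_le (by norm_num) hε1.le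
            _ = 2 := by norm_num
        have h6 : (1 / 27 : ℝ) ≤ (1 + ρ * ‖ξ‖) ^ (-3 : ℝ) := by
          rw [Real.rpow_neg (by positivity), ← one_div]
          have : (1 + ρ * ‖ξ‖) ^ (3 : ℝ) ≤ 27 := by
            calc (1 + ρ * ‖ξ‖) ^ (3 : ℝ) ≤ 3 ^ (3 : ℝ) := by gcongr; linarith
              _ = 27 := by norm_num
          gcongr
        calc ‖m₁ ξ‖ ≤ A * (2 * ρ ^ (-ε)) := h3.trans (by gcongr)
          _ = 54 * A * ρ ^ (-ε) * (1 / 27) := by ring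
          _ ≤ _ := by gcongr
    · rw [integral_const_mul, integral_one_add_mul_norm_rpow _ hρ, ← hρε]
      ring
  -- high frequencies
  have h2 : ‖invFourier m₂ x‖ ≤ 64 * B * J * A * ρ ^ (-2 - ε) := by
    -- Three derivatives leave `‖ξ‖ ^ (ε - 3)`, integrable at infinity in the plane because `3 - ε >
    -- 2`. In `64 = 8 * 8`, one `8` comes from adding two equal rates and cubing, the other from
    -- replacing `ρ ‖ξ‖ ≥ 1` by `1 + ρ ‖ξ‖`.
    have h3 := norm_pow_mul_norm_invFourier_le hm₂s hm₂c 3 x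
    have hg := (integrable_one_add_mul_norm_rpow (b := 3 - ε) (by linarith) hρ).const_mul
      (64 * B * A * ρ ^ (3 - ε))
    have h4 : ∫ ξ, ‖iteratedFDeriv ℝ 3 m₂ ξ‖ ≤
        ∫ ξ : Plane, 64 * B * A * ρ ^ (3 - ε) * (1 + ρ * ‖ξ‖) ^ (-(3 - ε)) := by
      refine integral_mono_of_nonneg (ae_of_all _ fun ξ => norm_nonneg _) hg
        (ae_of_all _ fun ξ => ?_)
      rcases lt_or_ge (ρ * ‖ξ‖) 1 with h | h
      · simp only [((hzero ξ h).iteratedFDeriv ℝ 3).eq_of_nhds, iteratedFDeriv_fun_zero,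
          Pi.zero_apply, norm_zero]
        positivity
      · have hξ : 0 < ‖ξ‖ := by
          by_contra hc
          have : ‖ξ‖ = 0 := le_antisymm (not_lt.1 hc) (norm_nonneg _)
          rw [this] at h; norm_num at h
        have h0 : ξ ≠ 0 := norm_pos_iff.1 hξ
        have h5 : SymbolBoundAt (fun η => ψ (ρ • η)) ξ B ‖ξ‖⁻¹ := by
          have := (hψs (ρ • ξ) trivial (smul_ne_zero hρ.ne' h0)).comp_smul hρ
          rw [hnorm, Real.rpow_zero, mul_one] at this
          have e : ρ * (ρ * ‖ξ‖)⁻¹ = ‖ξ‖⁻¹ := by field_simp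
          rwa [e] at this
        have h6 := h5.mul (hs ξ h0) hψρ.contDiffOn hm h0 3 le_rfl
        refine h6.trans ?_
        have h7 : ‖ξ‖ ^ ε * ‖ξ‖⁻¹ ^ 3 = ρ ^ (3 - ε) * (ρ * ‖ξ‖) ^ (-(3 - ε)) := by
          rw [Real.mul_rpow hρ.le hξ.le, ← mul_assoc, ← Real.rpow_add hρ, add_neg_cancel,
            Real.rpow_zero, one_mul, inv_pow, ← Real.rpow_natCast, ← Real.rpow_neg hξ.le,
            ← Real.rpow_add hξ]
          congr 1; push_cast; ring
        have h8 : (ρ * ‖ξ‖) ^ (-(3 - ε)) ≤ 8 * (1 + ρ * ‖ξ‖) ^ (-(3 - ε)) := by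
          have e1 : (2 * (ρ * ‖ξ‖)) ^ (-(3 - ε)) ≤ (1 + ρ * ‖ξ‖) ^ (-(3 - ε)) :=
            Real.rpow_le_rpow_of_nonpos (by positivity) (by linarith) (by linarith)
          have e2 : (1 : ℝ) ≤ 8 * 2 ^ (-(3 - ε)) := by
            have : (2 : ℝ) ^ (-3 : ℝ) ≤ 2 ^ (-(3 - ε)) :=
              Real.rpow_le_rpow_of_exponent_le (by norm_num) (by linarith)
            have e3 : (2 : ℝ) ^ (-3 : ℝ) = 1 / 8 := by
              rw [Real.rpow_neg (by norm_num)]; norm_num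
            rw [e3] at this
            linarith
          rw [Real.mul_rpow (by norm_num) (by positivity)] at e1
          calc (ρ * ‖ξ‖) ^ (-(3 - ε)) ≤ (8 * 2 ^ (-(3 - ε))) * (ρ * ‖ξ‖) ^ (-(3 - ε)) :=
                le_mul_of_one_le_left (by positivity) e2
            _ = 8 * (2 ^ (-(3 - ε)) * (ρ * ‖ξ‖) ^ (-(3 - ε))) := by ring
            _ ≤ _ := by gcongr
        calc B * (A * ‖ξ‖ ^ ε) * (‖ξ‖⁻¹ + ‖ξ‖⁻¹) ^ 3
            = 8 * B * A * (‖ξ‖ ^ ε * ‖ξ‖⁻¹ ^ 3) := by ring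
          _ ≤ 8 * B * A * (ρ ^ (3 - ε) * (8 * (1 + ρ * ‖ξ‖) ^ (-(3 - ε)))) := by
              rw [h7]; gcongr
          _ = _ := by ring
    rw [integral_const_mul, integral_one_add_mul_norm_rpow _ hρ] at h4
    have h5 := h3.trans h4
    refine le_of_mul_le_mul_left (h5.trans (le_of_eq ?_)) (pow_pos hρ 3)
    have h6 : ρ ^ (3 - ε) = ρ ^ 3 * ρ ^ (-ε) := by
      rw [← Real.rpow_natCast, ← Real.rpow_add hρ]
      congr 1
    rw [h6, ← hρε, ← hJ]
    ring
  rw [hsplit]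
  refine (norm_add_le _ _).trans ((add_le_add h1 h2).trans (le_of_eq ?_))
  ring

end

/-! ### `L¹_uloc` functions against decaying weights. -/

/-- Rounding both coordinates moves a point by at most `1 / √2 ≤ 3 / 4`, and `3 / 4 + 1 / 4 = 1`. -/
theorem lintegral_ball_quarter_le_l1ulocNorm (u : Plane → ℂ) (y : Plane) :
    ∫⁻ x in Metric.ball y (1 / 4), ‖u x‖ₑ ≤ l1ulocNorm u := by
  refine le_trans (lintegral_mono_set ?_)
    (le_iSup (fun k : Fin 2 → ℤ => ∫⁻ x in Metric.ball
      (WithLp.toLp 2 fun j => (k j : ℝ) : Plane) 1, ‖u x‖ₑ) fun j => round (y j))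
  have hd : dist y (WithLp.toLp 2 fun j => ((round (y j) : ℤ) : ℝ)) ≤ 3 / 4 := by
    rw [EuclideanSpace.dist_eq, Real.sqrt_le_left (by norm_num)]
    have h : ∀ j : Fin 2, dist (y j) ((round (y j) : ℤ) : ℝ) ^ 2 ≤ 1 / 4 := fun j => by
      rw [Real.dist_eq]
      have := abs_sub_round (y j)
      have h0 := abs_nonneg (y j - round (y j))
      nlinarith
    have h0 := h 0
    have h1 := h 1
    rw [Fin.sum_univ_two]
    simp only
    linarith
  exact Metric.ball_subset_ball' (by linarith)

theorem lintegral_one_add_norm_div_rpow {s L : ℝ} (hs : 2 < s) (hL : 0 < L) :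
    ∫⁻ t : Plane, ENNReal.ofReal ((1 + ‖t‖ / L) ^ (-s))
      = ENNReal.ofReal (L ^ 2 * ∫ ξ : Plane, (1 + ‖ξ‖) ^ (-s)) := by
  have h1 := integrable_one_add_mul_norm_rpow hs (inv_pos.2 hL)
  have h2 := integral_one_add_mul_norm_rpow s (inv_pos.2 hL)
  rw [inv_pow, inv_inv] at h2
  rw [← h2, ofReal_integral_eq_lintegral_ofReal h1 (ae_of_all _ fun t => by positivity)]
  simp only [div_eq_inv_mul]

/-- Convolution with the weight `(1 + |t| / L) ^ (-s)` maps `L¹_uloc` to bounded functions. -/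
theorem exists_lintegral_weight_mul_le {s : ℝ} (hs : 2 < s) :
    ∃ C : ℝ≥0, ∀ L : ℝ, 1 ≤ L → ∀ u : Plane → ℂ, Measurable u → ∀ x : Plane,
      ∫⁻ t : Plane, ENNReal.ofReal ((1 + ‖t‖ / L) ^ (-s)) * ‖u (x - t)‖ₑ
        ≤ C * ENNReal.ofReal (L ^ 2) * l1ulocNorm u := by
  set J := ∫ ξ : Plane, (1 + ‖ξ‖) ^ (-s) with hJ
  have hJ0 : 0 ≤ J := integral_nonneg fun ξ => by positivity
  set v : ℝ≥0∞ := volume (Metric.ball (0 : Plane) (1 / 4)) with hv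
  have hv0 : v ≠ 0 := (Metric.measure_ball_pos _ _ (by norm_num)).ne'
  have hvt : v ≠ ⊤ := measure_ball_lt_top.ne
  refine ⟨(v⁻¹ * ENNReal.ofReal (2 ^ s) * ENNReal.ofReal J).toNNReal, fun L hL u hu x => ?_⟩
  have hLpos : 0 < L := one_pos.trans_le hL
  rw [ENNReal.coe_toNNReal (by finiteness)]
  set w : Plane → ℝ≥0∞ := fun t => ENNReal.ofReal ((1 + ‖t‖ / L) ^ (-s)) with hw
  have hwm : Measurable w := by fun_prop
  -- As `L ≥ 1`, a shift by `1 / 4` at most doubles `1 + ‖t‖ / L`.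
  have hcmp : ∀ t y : Plane, dist y t < 1 / 4 → w t ≤ ENNReal.ofReal (2 ^ s) * w y := by
    intro t y hty
    rw [hw, ← ENNReal.ofReal_mul (by positivity)]
    refine ENNReal.ofReal_le_ofReal ?_
    have h1 : ‖y‖ ≤ ‖t‖ + 1 / 4 := by
      have := norm_sub_norm_le y t
      rw [dist_eq_norm] at hty
      linarith
    have h2 : 1 + ‖y‖ / L ≤ 2 * (1 + ‖t‖ / L) := by
      have h3 : ‖y‖ / L ≤ (‖t‖ + 1 / 4) / L := by gcongr
      have h4 : (1 / 4) / L ≤ 1 / 4 := div_le_self (by norm_num) hL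
      have h5 : 0 ≤ ‖t‖ / L := by positivity
      rw [add_div] at h3
      linarith
    have h3 : (2 * (1 + ‖t‖ / L)) ^ (-s) ≤ (1 + ‖y‖ / L) ^ (-s) :=
      Real.rpow_le_rpow_of_nonpos (by positivity) h2 (by linarith)
    rw [Real.mul_rpow (by norm_num) (by positivity), Real.rpow_neg (by norm_num)] at h3
    rwa [inv_mul_le_iff₀ (by positivity)] at h3
  -- In place of a sum over lattice cells, the weight is averaged over the balls `dist y t < 1 / 4`
  -- and the integrals are exchanged by Tonelli. The integral in `t` then sees `u` only on a ball of
  -- radius `1 / 4`, and the integral in `y` sees only the weight.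
  set I : Set (Plane × Plane) := {q | dist q.2 q.1 < 1 / 4} with hI
  have hIm : MeasurableSet I := (isOpen_lt (by fun_prop) continuous_const).measurableSet
  have hum : Measurable fun t => ‖u (x - t)‖ₑ := by fun_prop
  have hF : Measurable (Function.uncurry fun t y : Plane =>
      I.indicator (fun q : Plane × Plane => w q.2 * ‖u (x - q.1)‖ₑ) (t, y)) := by
    have : Measurable fun q : Plane × Plane => w q.2 * ‖u (x - q.1)‖ₑ := by fun_prop
    exact this.indicator hIm
  have hstep : ∀ t, v * (w t * ‖u (x - t)‖ₑ) ≤ ENNReal.ofReal (2 ^ s) *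
      ∫⁻ y, I.indicator (fun q : Plane × Plane => w q.2 * ‖u (x - q.1)‖ₑ) (t, y) := by
    intro t
    have h1 : v = ∫⁻ y in Metric.ball t (1 / 4), 1 := by
      rw [setLIntegral_one]
      exact (Measure.addHaar_ball_center volume t _).symm
    have h2 : ∫⁻ y, I.indicator (fun q : Plane × Plane => w q.2 * ‖u (x - q.1)‖ₑ) (t, y)
        = ∫⁻ y in Metric.ball t (1 / 4), w y * ‖u (x - t)‖ₑ := by
      rw [← lintegral_indicator measurableSet_ball]
      rfl
    rw [h2, ← lintegral_const_mul _ (by fun_prop), h1, ← lintegral_mul_const _ (by fun_prop)]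
    refine setLIntegral_mono (by fun_prop) fun y hy => ?_
    rw [one_mul, ← mul_assoc]
    gcongr
    exact hcmp t y hy
  have hinner : ∀ y, ∫⁻ t, I.indicator (fun q : Plane × Plane => w q.2 * ‖u (x - q.1)‖ₑ) (t, y)
      ≤ w y * l1ulocNorm u := by
    intro y
    have h1 : ∀ t, I.indicator (fun q : Plane × Plane => w q.2 * ‖u (x - q.1)‖ₑ) (t, y)
        = w y * (Metric.ball (x - y) (1 / 4)).indicator (fun p => ‖u p‖ₑ) (x - t) := by
      intro t
      have hiff : (t, y) ∈ I ↔ x - t ∈ Metric.ball (x - y) (1 / 4) := by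
        rw [hI, Set.mem_ofPred_eq, Metric.mem_ball, dist_eq_norm, dist_eq_norm]
        simp
      by_cases h : (t, y) ∈ I
      · rw [Set.indicator_of_mem h, Set.indicator_of_mem (hiff.1 h)]
      · rw [Set.indicator_of_notMem h, Set.indicator_of_notMem (fun h' => h (hiff.2 h')), mul_zero]
    have hm : Measurable ((Metric.ball (x - y) (1 / 4)).indicator fun p => ‖u p‖ₑ) :=
      Measurable.indicator (by fun_prop) measurableSet_ball
    have hm' : Measurable fun t =>
        (Metric.ball (x - y) (1 / 4)).indicator (fun p => ‖u p‖ₑ) (x - t) :=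
      hm.comp (measurable_const.sub measurable_id)
    simp only [h1]
    rw [lintegral_const_mul _ hm',
      lintegral_sub_left_eq_self (fun p => (Metric.ball (x - y) (1 / 4)).indicator
        (fun p => ‖u p‖ₑ) p) x, lintegral_indicator measurableSet_ball]
    gcongr
    exact lintegral_ball_quarter_le_l1ulocNorm u _
  have hmain : v * ∫⁻ t, w t * ‖u (x - t)‖ₑ
      ≤ ENNReal.ofReal (2 ^ s) * (ENNReal.ofReal (L ^ 2 * J) * l1ulocNorm u) := by
    rw [← lintegral_const_mul _ (by fun_prop)]
    refine (lintegral_mono hstep).trans ?_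
    rw [lintegral_const_mul' _ _ ENNReal.ofReal_ne_top]
    gcongr
    rw [lintegral_lintegral_swap hF.aemeasurable]
    refine (lintegral_mono hinner).trans (le_of_eq ?_)
    rw [lintegral_mul_const _ hwm, lintegral_one_add_norm_div_rpow hs hLpos]
  have h3 : ∫⁻ t, w t * ‖u (x - t)‖ₑ = v⁻¹ * (v * ∫⁻ t, w t * ‖u (x - t)‖ₑ) := by
    rw [← mul_assoc, ENNReal.inv_mul_cancel hv0 hvt, one_mul]
  rw [h3]
  refine (mul_le_mul_right hmain _).trans (le_of_eq ?_)
  rw [ENNReal.ofReal_mul (by positivity)]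
  ring

/-! ### Kernel bounds at the length scale `L z`. -/

/-- The uniform bound serves for `r ≤ L` and the decay for `r > L`; either loses at most `2 ^ (2 +
ε) ≤ 8`. -/
theorem le_weight_of_le_of_le {ε L M r v : ℝ} (hε : 0 < ε) (hε1 : ε < 1) (hL : 0 < L)
    (hM : 0 ≤ M) (hr : 0 ≤ r) (h1 : v ≤ M) (h2 : r ≠ 0 → v ≤ M * L ^ (2 + ε) * r ^ (-2 - ε)) :
    v ≤ 8 * M * (1 + r / L) ^ (-(2 + ε)) := by
  have h8 : (2 : ℝ) ^ (-(2 + ε)) ≥ 1 / 8 := by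
    have h : (2 : ℝ) ^ (-3 : ℝ) ≤ 2 ^ (-(2 + ε)) :=
      Real.rpow_le_rpow_of_exponent_le (by norm_num) (by linarith)
    have e3 : (2 : ℝ) ^ (-3 : ℝ) = 1 / 8 := by
      rw [Real.rpow_neg (by norm_num)]; norm_num
    rwa [e3] at h
  have hrL : 0 ≤ r / L := by positivity
  rcases le_or_gt r L with h | h
  · have h3 : r / L ≤ 1 := (div_le_one hL).2 h
    have h4 : (2 : ℝ) ^ (-(2 + ε)) ≤ (1 + r / L) ^ (-(2 + ε)) :=
      Real.rpow_le_rpow_of_nonpos (by positivity) (by linarith) (by linarith)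
    calc v ≤ 8 * M * (1 / 8) := by linarith
      _ ≤ _ := by gcongr; exact h8.le.trans h4
  · have hr0 : 0 < r := hL.trans h
    have h3 : 1 ≤ r / L := (one_le_div hL).2 h.le
    have h4 : (2 * (r / L)) ^ (-(2 + ε)) ≤ (1 + r / L) ^ (-(2 + ε)) :=
      Real.rpow_le_rpow_of_nonpos (by positivity) (by linarith) (by linarith)
    rw [Real.mul_rpow (by norm_num) hrL, Real.div_rpow hr hL.le, Real.rpow_neg hL.le (2 + ε),
      div_inv_eq_mul] at h4
    have e : -2 - ε = -(2 + ε) := by ring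
    calc v ≤ M * (L ^ (2 + ε) * r ^ (-(2 + ε))) := by rw [← mul_assoc, ← e]; exact h2 hr0.ne'
      _ = 8 * M * (1 / 8 * (r ^ (-(2 + ε)) * L ^ (2 + ε))) := by ring
      _ ≤ 8 * M * (2 ^ (-(2 + ε)) * (r ^ (-(2 + ε)) * L ^ (2 + ε))) := by gcongr
      _ ≤ _ := by gcongr

/-- Pointwise bounds on the kernels of the multipliers `a(D) exp(-l(D) z)`, where `L z` is the
length scale and `W z` the amplitude. -/
theorem exists_norm_invFourier_le_weight {a l : Plane → ℂ} {α R b c : ℝ} {W L : ℝ → ℝ}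
    (hα : 0 < α)
    (ha : IsSymbolOn a Set.univ α) (haR : ∀ ξ, R < ‖ξ‖ → a ξ = 0)
    (hl : IsSymbolOn l (Metric.closedBall 0 R) b) (hc : 0 < c)
    (hlre : ∀ ξ, ξ ≠ 0 → ‖ξ‖ ≤ R → c * ‖ξ‖ ^ b ≤ (l ξ).re)
    (hW : ∀ z, 0 < z → 0 ≤ W z) (hL : ∀ z, 0 < z → 1 ≤ L z)
    (hWL : ∀ γ : ℝ, 0 ≤ γ → ∃ C : ℝ, 0 ≤ C ∧ ∀ z : ℝ, 0 < z → ∀ r : ℝ, 0 < r → r ≤ R →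
      r ^ γ * Real.exp (-(c / 2 * (z * r ^ b))) * (1 + L z * r) ^ 3 ≤ C * W z * L z ^ (-γ)) :
    ∃ ε : ℝ, 0 < ε ∧ ∃ C : ℝ, 0 ≤ C ∧ ∀ z : ℝ, 0 < z →
      Integrable (fun ξ => a ξ * Complex.exp (-(l ξ) * z)) ∧
      ∀ x, ‖invFourier (fun ξ => a ξ * Complex.exp (-(l ξ) * z)) x‖
        ≤ C * (W z * L z ^ (-(2 + α))) * (1 + ‖x‖ / L z) ^ (-(2 + ε)) := by
  -- `ε < 1` is required by the Fourier decay estimate; `ε ≤ α` leaves a surplus `‖ξ‖ ^ (α - ε)`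
  -- that is turned into a power of `L z`.
  set ε := min α (1 / 2) with hε
  have hε0 : 0 < ε := lt_min hα (by norm_num)
  have hε1 : ε < 1 := (min_le_right _ _).trans_lt (by norm_num)
  have hεα : ε ≤ α := min_le_left _ _
  obtain ⟨C₀, hC₀, hs⟩ := exists_symbolBoundAt_mul_cexp ha haR hl hc hlre
  -- The exponent `γ = α` gives the uniform bound on the kernel, `γ = α - ε` its tail.
  obtain ⟨C₁, hC₁, h₁⟩ := hWL α hα.le
  obtain ⟨C₂, hC₂, h₂⟩ := hWL (α - ε) (by linarith)
  obtain ⟨C₃, hC₃, h₃⟩ := exists_norm_invFourier_le hε0 hε1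
  set J := ∫ ξ : Plane, (1 + ‖ξ‖) ^ (-3 : ℝ) with hJ
  have hJ0 : 0 ≤ J := integral_nonneg fun ξ => by positivity
  set N := C₀ * C₁ * J + C₃ * (C₀ * C₂) with hN
  clear_value ε J N
  have hN0 : 0 ≤ N := by rw [hN]; positivity
  refine ⟨ε, hε0, 8 * N, by positivity, fun z hz => ?_⟩
  have hLz : 1 ≤ L z := hL z hz
  have hL0 : 0 < L z := one_pos.trans_le hLz
  have hWz := hW z hz
  set m : Plane → ℂ := fun ξ => a ξ * Complex.exp (-(l ξ) * z) with hm
  have hms : ContDiffOn ℝ ∞ m {0}ᶜ := ha.1.mul (hl.1.neg.mul contDiffOn_const).cexp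
  have hmR : ∀ ξ, R < ‖ξ‖ → m ξ = 0 := fun ξ h => by rw [hm]; simp only [haR ξ h, zero_mul]
  have hms0 : ∀ ξ, ξ ≠ 0 → SymbolBoundAt m ξ _ _ := fun ξ h => hs z hz.le ξ h
  have hmul : ∀ γ : ℝ, L z ^ (-γ) * (L z ^ 2)⁻¹ = L z ^ (-(2 + γ)) := fun γ => by
    rw [← Real.rpow_natCast, ← Real.rpow_neg hL0.le, ← Real.rpow_add hL0]
    congr 1; push_cast; ring
  have hpt : ∀ ξ, ξ ≠ 0 → ‖m ξ‖ ≤ C₀ * C₁ * W z * L z ^ (-α) * (1 + L z * ‖ξ‖) ^ (-3 : ℝ) := by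
    intro ξ h0
    have hp := norm_pos_iff.2 h0
    rcases lt_or_ge R ‖ξ‖ with h | h
    · rw [hmR ξ h, norm_zero]; positivity
    · have h4 := h₁ z hz ‖ξ‖ hp h
      have h5 : (1 + L z * ‖ξ‖) ^ (-3 : ℝ) = ((1 + L z * ‖ξ‖) ^ 3)⁻¹ := by
        rw [Real.rpow_neg (by positivity)]; norm_cast
      rw [h5, ← div_eq_mul_inv, le_div_iff₀ (by positivity)]
      calc ‖m ξ‖ * (1 + L z * ‖ξ‖) ^ 3
          ≤ (C₀ * ‖ξ‖ ^ α * Real.exp (-(c / 2 * (z * ‖ξ‖ ^ b)))) * (1 + L z * ‖ξ‖) ^ 3 := by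
            gcongr; exact (hms0 ξ h0).norm_le
        _ = C₀ * (‖ξ‖ ^ α * Real.exp (-(c / 2 * (z * ‖ξ‖ ^ b))) * (1 + L z * ‖ξ‖) ^ 3) := by ring
        _ ≤ C₀ * (C₁ * W z * L z ^ (-α)) := by gcongr
        _ = _ := by ring
  have hgint := (integrable_one_add_mul_norm_rpow (b := 3) (by norm_num) hL0).const_mul
    (C₀ * C₁ * W z * L z ^ (-α))
  refine ⟨hgint.mono' (aestronglyMeasurable_of_continuousOn_punctured hms.continuousOn)
    (ae_ne_zero_plane.mono fun ξ h0 => hpt ξ h0), fun x => ?_⟩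
  have hsup : ‖invFourier m x‖ ≤ N * (W z * L z ^ (-(2 + α))) := by
    refine (norm_invFourier_le_of_norm_le hgint hpt x).trans ?_
    rw [integral_const_mul, integral_one_add_mul_norm_rpow _ hL0, ← hmul α, hN]
    have : 0 ≤ C₃ * (C₀ * C₂) * (W z * (L z ^ (-α) * (L z ^ 2)⁻¹)) := by positivity
    rw [← hJ]
    nlinarith
  have hdec : x ≠ 0 → ‖invFourier m x‖ ≤ C₃ * (C₀ * (C₂ * W z * L z ^ (-(α - ε)))) *
      ‖x‖ ^ (-2 - ε) := by
    refine h₃ m _ R (by positivity) hms hmR (fun ξ h0 => ?_) x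
    have hp := norm_pos_iff.2 h0
    rcases lt_or_ge R ‖ξ‖ with h | h
    · have hz : (fun _ => 0) =ᶠ[𝓝 ξ] m := by
        filter_upwards [(isOpen_lt continuous_const continuous_norm).mem_nhds h] with η hη
        exact (hmR η hη).symm
      refine SymbolBoundAt.congr (fun i _ => ?_) hz
      simp only [iteratedFDeriv_fun_zero, Pi.zero_apply, norm_zero]
      positivity
    · refine (hms0 ξ h0).mono ?_ (by positivity) (by positivity) le_rfl
      have h4 := h₂ z hz ‖ξ‖ hp h
      have h5 : ‖ξ‖ ^ α = ‖ξ‖ ^ (α - ε) * ‖ξ‖ ^ ε := by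
        rw [← Real.rpow_add hp]; congr 1; ring
      have h6 : (1 : ℝ) ≤ (1 + L z * ‖ξ‖) ^ 3 :=
        one_le_pow₀ (by have : 0 ≤ L z * ‖ξ‖ := by positivity
                        linarith)
      calc C₀ * ‖ξ‖ ^ α * Real.exp (-(c / 2 * (z * ‖ξ‖ ^ b)))
          = C₀ * (‖ξ‖ ^ (α - ε) * Real.exp (-(c / 2 * (z * ‖ξ‖ ^ b)))) * ‖ξ‖ ^ ε := by
            rw [h5]; ring
        _ ≤ C₀ * (C₂ * W z * L z ^ (-(α - ε))) * ‖ξ‖ ^ ε := by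
            refine mul_le_mul_of_nonneg_right (mul_le_mul_of_nonneg_left ?_ hC₀) (by positivity)
            exact (le_mul_of_one_le_right (by positivity) h6).trans h4
  have hfin := le_weight_of_le_of_le (M := N * (W z * L z ^ (-(2 + α)))) hε0 hε1 hL0
    (by positivity) (norm_nonneg x) hsup (fun hx => (hdec (norm_ne_zero_iff.1 hx)).trans ?_)
  · refine hfin.trans (le_of_eq ?_)
    ring
  · have h7 : L z ^ (-(2 + α)) * L z ^ (2 + ε) = L z ^ (-(α - ε)) := by
      rw [← Real.rpow_add hL0]; congr 1; ring
    have h8 : N * (W z * L z ^ (-(2 + α))) * L z ^ (2 + ε) = N * (W z * L z ^ (-(α - ε))) := by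
      rw [← h7]; ring
    rw [h8]
    refine mul_le_mul_of_nonneg_right ?_ (Real.rpow_nonneg (norm_nonneg x) _)
    have : 0 ≤ C₀ * C₁ * J * (W z * L z ^ (-(α - ε))) := by positivity
    rw [hN]
    nlinarith

/-! ### Convolution with `L¹_uloc` data: measurability and bounds at each height. -/

theorem l1ulocNorm_congr {u v : Plane → ℂ} (h : u =ᵐ[volume] v) : l1ulocNorm u = l1ulocNorm v := by
  unfold l1ulocNorm
  congr 1
  ext k
  refine lintegral_congr_ae (ae_restrict_of_ae ?_)
  filter_upwards [h] with x hx
  rw [hx]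

theorem ae_eq_comp_sub_left {u v : Plane → ℂ} (h : u =ᵐ[volume] v) (x : Plane) :
    (fun t => u (x - t)) =ᵐ[volume] fun t => v (x - t) :=
  h.comp_tendsto (quasiMeasurePreserving_sub_left_of_right_invariant volume x).tendsto_ae

/-- Convolution of a kernel with weighted decay and a function in `L¹_uloc`. -/
theorem exists_lintegral_kernel_mul_le {s : ℝ} (hs : 2 < s) :
    ∃ C : ℝ≥0, ∀ (L B : ℝ) (K u : Plane → ℂ), 1 ≤ L → 0 ≤ B →
      (∀ t, ‖K t‖ ≤ B * (1 + ‖t‖ / L) ^ (-s)) → AEStronglyMeasurable u volume → ∀ x : Plane,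
      ∫⁻ t : Plane, ‖K t * u (x - t)‖ₑ ≤ C * ENNReal.ofReal (B * L ^ 2) * l1ulocNorm u := by
  obtain ⟨C, hC⟩ := exists_lintegral_weight_mul_le hs
  refine ⟨C, fun L B K u hL hB hK hu x => ?_⟩
  have h1 := hC L hL (hu.mk u) hu.stronglyMeasurable_mk.measurable x
  rw [← l1ulocNorm_congr hu.ae_eq_mk] at h1
  calc ∫⁻ t : Plane, ‖K t * u (x - t)‖ₑ
      ≤ ∫⁻ t : Plane, ENNReal.ofReal B *
          (ENNReal.ofReal ((1 + ‖t‖ / L) ^ (-s)) * ‖hu.mk u (x - t)‖ₑ) := by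
        refine lintegral_mono_ae ?_
        filter_upwards [ae_eq_comp_sub_left hu.ae_eq_mk x] with t ht
        rw [enorm_mul, ht, ← mul_assoc, ← ENNReal.ofReal_mul hB]
        gcongr
        rw [← ofReal_norm]
        exact ENNReal.ofReal_le_ofReal (hK t)
    _ = ENNReal.ofReal B *
          ∫⁻ t : Plane, ENNReal.ofReal ((1 + ‖t‖ / L) ^ (-s)) * ‖hu.mk u (x - t)‖ₑ :=
        lintegral_const_mul' _ _ ENNReal.ofReal_ne_top
    _ ≤ ENNReal.ofReal B * (C * ENNReal.ofReal (L ^ 2) * l1ulocNorm u) := by gcongr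
    _ = _ := by rw [ENNReal.ofReal_mul hB]; ring

/-- Joint measurability in `(x, z)` is what membership in `L^∞` of the half-space requires. -/
theorem stronglyMeasurable_decayKernel {χ P l : Plane → ℂ} (ha : Measurable fun ξ => χ ξ * P ξ)
    (hl : Measurable l) :
    StronglyMeasurable fun q : Plane × ℝ => decayKernel χ P l q.2 q.1 := by
  unfold decayKernel invFourier
  refine StronglyMeasurable.const_mul ?_ _
  refine StronglyMeasurable.integral_prod_right
    (f := fun (q : Plane × ℝ) (ξ : Plane) =>
      Complex.exp (Complex.I * (inner ℝ q.1 ξ : ℝ)) * decaySymbol χ P l q.2 ξ) ?_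
  refine Measurable.stronglyMeasurable ?_
  unfold Function.uncurry decaySymbol
  have h1 : Measurable fun p : (Plane × ℝ) × Plane => χ p.2 * P p.2 := ha.comp measurable_snd
  have h2 : Measurable fun p : (Plane × ℝ) × Plane => l p.2 := hl.comp measurable_snd
  have h3 : Measurable fun p : (Plane × ℝ) × Plane =>
      Complex.exp (Complex.I * (inner ℝ p.1.1 p.2 : ℝ)) :=
    Continuous.measurable (by fun_prop)
  have h4 : Measurable fun p : (Plane × ℝ) × Plane => (p.1.2 : ℂ) :=
    Continuous.measurable (by fun_prop)
  exact h3.mul (h1.mul (h2.neg.mul h4).cexp)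

theorem stronglyMeasurable_decayEvolution {χ P l u : Plane → ℂ}
    (ha : Measurable fun ξ => χ ξ * P ξ) (hl : Measurable l)
    (hu : AEStronglyMeasurable u volume) :
    StronglyMeasurable fun q : Plane × ℝ => decayEvolution χ P l u q.2 q.1 := by
  -- Passing to a measurable representative of `u` changes the convolution at no point.
  have h : ∀ z, decayEvolution χ P l u z = decayEvolution χ P l (hu.mk u) z := fun z =>
    convolution_congr _ (ae_eq_refl _) hu.ae_eq_mk
  simp only [h]
  refine StronglyMeasurable.integral_prod_right
    (f := fun (q : Plane × ℝ) (t : Plane) => decayKernel χ P l q.2 t * hu.mk u (q.1 - t)) ?_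
  unfold Function.uncurry
  have hK := (stronglyMeasurable_decayKernel ha hl).comp_measurable
    (g := fun p : (Plane × ℝ) × Plane => (p.2, p.1.2)) (by fun_prop)
  have hU := hu.stronglyMeasurable_mk.comp_measurable
    (g := fun p : (Plane × ℝ) × Plane => p.1.1 - p.2) (by fun_prop)
  exact hK.mul hU

/-- Well-definedness and height-dependent bounds for `χ(D) P(D) exp(-l(D) z)` on `L¹_uloc`. -/
theorem decayEvolution_bounds {χ P l : Plane → ℂ} {α R b c : ℝ} {W L : ℝ → ℝ}
    (hα : 0 < α)
    (ha : IsSymbolOn (fun ξ => χ ξ * P ξ) Set.univ α) (hχR : ∀ ξ, R < ‖ξ‖ → χ ξ = 0)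
    (hl : IsSymbolOn l (Metric.closedBall 0 R) b) (hc : 0 < c)
    (hlre : ∀ ξ, ξ ≠ 0 → ‖ξ‖ ≤ R → c * ‖ξ‖ ^ b ≤ (l ξ).re)
    (hW : ∀ z, 0 < z → 0 ≤ W z) (hL : ∀ z, 0 < z → 1 ≤ L z)
    (hWL : ∀ γ : ℝ, 0 ≤ γ → ∃ C : ℝ, 0 ≤ C ∧ ∀ z : ℝ, 0 < z → ∀ r : ℝ, 0 < r → r ≤ R →
      r ^ γ * Real.exp (-(c / 2 * (z * r ^ b))) * (1 + L z * r) ^ 3 ≤ C * W z * L z ^ (-γ)) :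
    (∀ z : ℝ, 0 < z → Integrable (decaySymbol χ P l z) volume ∧
      Integrable (decayKernel χ P l z) volume ∧
      ∀ u₀ : Plane → ℂ, MemL1uloc u₀ →
        ConvolutionExists (decayKernel χ P l z) u₀ (ContinuousLinearMap.mul ℂ ℂ) volume ∧
        MemLp (decayEvolution χ P l u₀ z) ∞ volume) ∧
    ∃ C : ℝ≥0, ∀ u₀ : Plane → ℂ, MemL1uloc u₀ → ∀ z : ℝ, 0 < z → ∀ x,
      ‖decayEvolution χ P l u₀ z x‖ₑ ≤ C * ENNReal.ofReal (W z * L z ^ (-α)) * l1ulocNorm u₀ := by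
  obtain ⟨ε, hε, C, hC, hK⟩ := exists_norm_invFourier_le_weight hα ha
    (fun ξ h => by simp only [hχR ξ h, zero_mul]) hl hc hlre hW hL hWL
  obtain ⟨D, hD⟩ := exists_lintegral_kernel_mul_le (s := 2 + ε) (by linarith)
  have ham : Measurable fun ξ => χ ξ * P ξ :=
    measurable_of_continuousOn_compl_singleton 0 ha.1.continuousOn
  have hlm : Measurable l := measurable_of_continuousOn_compl_singleton 0 hl.1.continuousOn
  have hKm : ∀ z, StronglyMeasurable (decayKernel χ P l z) := fun z =>
    (stronglyMeasurable_decayKernel ham hlm).comp_measurable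
      (g := fun x : Plane => (x, z)) (by fun_prop)
  have hB : ∀ z, 0 < z → 0 ≤ C * (W z * L z ^ (-(2 + α))) := fun z hz => by
    have := hW z hz
    have := one_pos.trans_le (hL z hz)
    positivity
  have hint : ∀ u₀ : Plane → ℂ, MemL1uloc u₀ → ∀ z : ℝ, 0 < z → ∀ x,
      ∫⁻ t : Plane, ‖decayKernel χ P l z t * u₀ (x - t)‖ₑ ≤
        (D * C.toNNReal : ℝ≥0) * ENNReal.ofReal (W z * L z ^ (-α)) * l1ulocNorm u₀ := by
    intro u₀ hu z hz x
    refine (hD (L z) _ (decayKernel χ P l z) u₀ (hL z hz) (hB z hz) (hK z hz).2 hu.1 x).trans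
      (le_of_eq ?_)
    have hLz := one_pos.trans_le (hL z hz)
    -- The area `L z ^ 2` from the convolution cancels the normalization of the kernel and leaves
    -- the decay `L z ^ (-α)`.
    have h1 : L z ^ (-(2 + α)) * L z ^ 2 = L z ^ (-α) := by
      rw [← Real.rpow_natCast, ← Real.rpow_add hLz]
      congr 1; push_cast; ring
    have h2 : C * (W z * L z ^ (-(2 + α))) * L z ^ 2 = C * (W z * L z ^ (-α)) := by
      rw [← h1]; ring
    rw [h2, ENNReal.ofReal_mul hC, ENNReal.coe_mul]
    simp only [ENNReal.ofReal]
    ring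
  have hbd : ∀ u₀ : Plane → ℂ, MemL1uloc u₀ → ∀ z : ℝ, 0 < z → ∀ x,
      ‖decayEvolution χ P l u₀ z x‖ₑ ≤
        (D * C.toNNReal : ℝ≥0) * ENNReal.ofReal (W z * L z ^ (-α)) * l1ulocNorm u₀ :=
    fun u₀ hu z hz x => (enorm_integral_le_lintegral_enorm _).trans (hint u₀ hu z hz x)
  refine ⟨fun z hz => ⟨(hK z hz).1, ?_, fun u₀ hu => ⟨fun x => ⟨?_, ?_⟩, ?_, ?_⟩⟩, _, hbd⟩
  · have hLz := one_pos.trans_le (hL z hz)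
    refine ((integrable_one_add_mul_norm_rpow (b := 2 + ε) (by linarith)
      (inv_pos.2 hLz)).const_mul (C * (W z * L z ^ (-(2 + α))))).mono'
      (hKm z).aestronglyMeasurable (ae_of_all _ fun x => ?_)
    have := (hK z hz).2 x
    rwa [div_eq_inv_mul] at this
  · exact (hKm z).aestronglyMeasurable.mul (hu.1.comp_quasiMeasurePreserving
      (quasiMeasurePreserving_sub_left_of_right_invariant volume x))
  · refine (hint u₀ hu z hz x).trans_lt ?_
    have := hu.2
    finiteness
  · exact ((stronglyMeasurable_decayEvolution ham hlm hu.1).comp_measurable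
      (g := fun x : Plane => (x, z)) (by fun_prop)).aestronglyMeasurable
  · rw [eLpNorm_exponent_top]
    refine (eLpNormEssSup_le_of_ae_enorm_bound (ae_of_all _ fun x => hbd u₀ hu z hz x)).trans_lt ?_
    have := hu.2
    finiteness

/-- Here `W` is the full height profile, amplitude times `L z ^ (-α)`, and `g` is a weight that it
compensates. The bound holds at every point, so no null sets depending on the height arise. -/
theorem memLp_top_mul_decayEvolution {χ P l u₀ : Plane → ℂ} {W g : ℝ → ℝ} {C : ℝ≥0}
    (ha : Measurable fun ξ => χ ξ * P ξ) (hl : Measurable l) (hu : MemL1uloc u₀)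
    (hg : Measurable g) (hgW : ∀ z, 0 < z → |g z| * W z ≤ 1)
    (hbd : ∀ z : ℝ, 0 < z → ∀ x,
      ‖decayEvolution χ P l u₀ z x‖ₑ ≤ C * ENNReal.ofReal (W z) * l1ulocNorm u₀) :
    MemLp (fun y : Plane × ℝ => (g y.2 : ℂ) * decayEvolution χ P l u₀ y.2 y.1) ∞
        halfSpaceVolume ∧
      eLpNorm (fun y : Plane × ℝ => (g y.2 : ℂ) * decayEvolution χ P l u₀ y.2 y.1) ∞
        halfSpaceVolume ≤ C * l1ulocNorm u₀ := by
  have hS : MeasurableSet {y : Plane × ℝ | 0 < y.2} :=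
    measurableSet_lt measurable_const measurable_snd
  have hle : eLpNorm (fun y : Plane × ℝ => (g y.2 : ℂ) * decayEvolution χ P l u₀ y.2 y.1) ∞
      halfSpaceVolume ≤ C * l1ulocNorm u₀ := by
    rw [eLpNorm_exponent_top]
    refine eLpNormEssSup_le_of_ae_enorm_bound (ae_restrict_of_forall_mem hS fun y hy => ?_)
    have hy' : 0 < y.2 := hy
    rw [enorm_mul]
    have h1 : ‖(g y.2 : ℂ)‖ₑ = ENNReal.ofReal |g y.2| := by
      rw [← ofReal_norm, Complex.norm_real, Real.norm_eq_abs]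
    have h2 : ENNReal.ofReal |g y.2| * ENNReal.ofReal (W y.2) ≤ 1 := by
      rw [← ENNReal.ofReal_mul (abs_nonneg _)]
      exact ENNReal.ofReal_le_one.2 (hgW _ hy')
    rw [h1]
    calc _ ≤ ENNReal.ofReal |g y.2| * (C * ENNReal.ofReal (W y.2) * l1ulocNorm u₀) := by
          gcongr; exact hbd _ hy' _
      _ = (ENNReal.ofReal |g y.2| * ENNReal.ofReal (W y.2)) * (C * l1ulocNorm u₀) := by ring
      _ ≤ 1 * (C * l1ulocNorm u₀) := by gcongr
      _ = _ := one_mul _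
  refine ⟨⟨?_, hle.trans_lt ?_⟩, hle⟩
  · refine StronglyMeasurable.aestronglyMeasurable (StronglyMeasurable.mul ?_
      (stronglyMeasurable_decayEvolution ha hl hu.1))
    exact (Complex.measurable_ofReal.comp (hg.comp measurable_snd)).stronglyMeasurable
  · have := hu.2
    finiteness

/-! ### Choice of scales for the two kinds of roots, and conclusion. -/

theorem exists_pos_eq_zero_of_lt_norm {χ : Plane → ℂ} (hχ : HasCompactSupport χ) :
    ∃ R : ℝ, ∀ ξ, R < ‖ξ‖ → χ ξ = 0 := by
  obtain ⟨R, hR⟩ := hχ.isCompact.isBounded.subset_closedBall 0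
  refine ⟨R, fun ξ hξ => image_eq_zero_of_notMem_tsupport fun h => ?_⟩
  exact hξ.not_ge (by simpa using hR h)

/-- The scale hypothesis `hWL` for `λ₂` and `λ₃`: with `L = 1`, all factors but the exponential are
bounded on `r ≤ R`. -/
theorem exists_rpow_mul_exp_le_of_order_zero (R c γ : ℝ) (hγ : 0 ≤ γ) :
    ∃ C : ℝ, 0 ≤ C ∧ ∀ z : ℝ, 0 < z → ∀ r : ℝ, 0 < r → r ≤ R →
      r ^ γ * Real.exp (-(c / 2 * (z * r ^ (0 : ℝ)))) * (1 + 1 * r) ^ 3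
        ≤ C * Real.exp (-(c / 2 * z)) * 1 ^ (-γ) := by
  refine ⟨|R| ^ γ * (1 + |R|) ^ 3, by positivity, fun z _ r hr hrR => ?_⟩
  have hrR' : r ≤ |R| := hrR.trans (le_abs_self R)
  rw [Real.rpow_zero, Real.one_rpow, mul_one, mul_one, one_mul]
  calc r ^ γ * Real.exp (-(c / 2 * z)) * (1 + r) ^ 3
      ≤ |R| ^ γ * Real.exp (-(c / 2 * z)) * (1 + |R|) ^ 3 := by gcongr
    _ = _ := by ring

/-- The scale hypothesis `hWL` for `λ₁`. Since `L ^ 3 = 1 + z`, one has `(L r) ^ 3 = r ^ 3 + z r ^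
3`, so powers of `L r` are absorbed by the exponential in `z r ^ 3`, and `r ^ γ = L ^ (-γ) (L r) ^
γ` yields the decay. -/
theorem exists_rpow_mul_exp_le_of_order_three {R c γ : ℝ} (hc : 0 < c) (hγ : 0 ≤ γ) :
    ∃ C : ℝ, 0 ≤ C ∧ ∀ z : ℝ, 0 < z → ∀ r : ℝ, 0 < r → r ≤ R →
      r ^ γ * Real.exp (-(c / 2 * (z * r ^ (3 : ℝ)))) * (1 + (1 + z) ^ (1 / 3 : ℝ) * r) ^ 3
        ≤ C * 1 * ((1 + z) ^ (1 / 3 : ℝ)) ^ (-γ) := by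
  obtain ⟨M, hM, h⟩ := exists_rpow_mul_exp_neg_le (A := 2 + |R| ^ 3) (B := 1) (b := γ + 3)
    (c := c / 2) (by positivity) zero_le_one (by positivity) (by positivity)
  refine ⟨M, hM, fun z hz r hr hrR => ?_⟩
  have hrR' : r ≤ |R| := hrR.trans (le_abs_self R)
  have hz1 : 0 < 1 + z := by linarith
  set L := (1 + z) ^ (1 / 3 : ℝ) with hL
  have hL0 : 0 < L := by positivity
  have hL3 : L ^ 3 = 1 + z := by
    rw [hL, ← Real.rpow_natCast, ← Real.rpow_mul hz1.le]
    norm_num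
  have hr3 : r ^ (3 : ℝ) = r ^ 3 := by exact_mod_cast Real.rpow_natCast r 3
  rw [hr3, mul_one]
  set x := z * r ^ 3 with hx
  have hx0 : 0 ≤ x := by positivity
  have hy : 0 < L * r := by positivity
  have h1 : 1 + L * r ≤ 2 + |R| ^ 3 + 1 * x := by
    have e1 : (L * r) ^ 3 = r ^ 3 + x := by rw [mul_pow, hL3, hx]; ring
    have e2 : L * r ≤ 1 + (L * r) ^ 3 := by
      rcases le_or_gt (L * r) 1 with h | h
      · have : 0 ≤ (L * r) ^ 3 := by positivity
        linarith
      · have := le_self_pow₀ h.le (n := 3) (by norm_num)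
        linarith
    have e3 : r ^ 3 ≤ |R| ^ 3 := by gcongr
    linarith
  have h2 : r ^ γ = L ^ (-γ) * (L * r) ^ γ := by
    rw [Real.mul_rpow hL0.le hr.le, ← mul_assoc, ← Real.rpow_add hL0, neg_add_cancel,
      Real.rpow_zero, one_mul]
  have h3 : (L * r) ^ γ * (1 + L * r) ^ 3 ≤ (2 + |R| ^ 3 + 1 * x) ^ (γ + 3) := by
    calc (L * r) ^ γ * (1 + L * r) ^ 3 ≤ (1 + L * r) ^ γ * (1 + L * r) ^ 3 := by
          gcongr; linarith
      _ = (1 + L * r) ^ (γ + 3) := by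
          rw [Real.rpow_add (by positivity)]; norm_cast
      _ ≤ _ := by gcongr
  calc r ^ γ * Real.exp (-(c / 2 * x)) * (1 + L * r) ^ 3
      = L ^ (-γ) * (((L * r) ^ γ * (1 + L * r) ^ 3) * Real.exp (-(c / 2 * x))) := by
        rw [h2]; ring
    _ ≤ L ^ (-γ) * ((2 + |R| ^ 3 + 1 * x) ^ (γ + 3) * Real.exp (-(c / 2 * x))) := by gcongr
    _ ≤ L ^ (-γ) * M := by gcongr; exact h x hx0
    _ = M * L ^ (-γ) := mul_comm _ _

theorem mainTheorem4
    (χ P Q : Plane → ℂ) (k : ℕ) (p : MvPolynomial (Fin 2) ℂ) (α : ℝ)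
    (hχ : ContDiff ℝ ∞ χ) (hχc : HasCompactSupport χ)
    (hP : ContDiffOn ℝ ∞ P {0}ᶜ)
    (hp : p.IsHomogeneous k) (hα : 0 < α) (hαk : -2 ≤ α - k)
    (hQ : ContDiff ℝ ∞ Q)
    (hPQ : ∀ᶠ ξ : Plane in 𝓝[≠] 0,
      P ξ = MvPolynomial.eval (fun j => (ξ j : ℂ)) p * ((‖ξ‖ ^ (α - k) : ℝ) : ℂ) * Q ξ) :
    -- the multipliers are well defined on `L¹_uloc`, with values in `L^∞` at each height
    (∀ l ∈ ({charRoot₁, charRoot₂, charRoot₃} : Set (Plane → ℂ)), ∀ z : ℝ, 0 < z →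
      Integrable (decaySymbol χ P l z) volume ∧
      Integrable (decayKernel χ P l z) volume ∧
      ∀ u₀ : Plane → ℂ, MemL1uloc u₀ →
        ConvolutionExists (decayKernel χ P l z) u₀ (ContinuousLinearMap.mul ℂ ℂ) volume ∧
        MemLp (decayEvolution χ P l u₀ z) ∞ volume) ∧
    -- exponential decay for the second and third roots
    (∃ C : ℝ≥0, ∃ δ : ℝ, 0 < δ ∧ ∀ u₀ : Plane → ℂ, MemL1uloc u₀ →
      MemLp (fun y : Plane × ℝ =>
        (Real.exp (δ * y.2) : ℂ) * decayEvolution χ P charRoot₂ u₀ y.2 y.1)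
        ∞ halfSpaceVolume ∧
      MemLp (fun y : Plane × ℝ =>
        (Real.exp (δ * y.2) : ℂ) * decayEvolution χ P charRoot₃ u₀ y.2 y.1)
        ∞ halfSpaceVolume ∧
      eLpNorm (fun y : Plane × ℝ =>
          (Real.exp (δ * y.2) : ℂ) * decayEvolution χ P charRoot₂ u₀ y.2 y.1)
          ∞ halfSpaceVolume +
        eLpNorm (fun y : Plane × ℝ =>
          (Real.exp (δ * y.2) : ℂ) * decayEvolution χ P charRoot₃ u₀ y.2 y.1)
          ∞ halfSpaceVolume
        ≤ C * l1ulocNorm u₀) ∧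
    -- algebraic decay for the first root
    (∃ C : ℝ≥0, ∀ u₀ : Plane → ℂ, MemL1uloc u₀ →
      MemLp (fun y : Plane × ℝ =>
        (((1 + y.2) ^ (α / 3) : ℝ) : ℂ) * decayEvolution χ P charRoot₁ u₀ y.2 y.1)
        ∞ halfSpaceVolume ∧
      eLpNorm (fun y : Plane × ℝ =>
          (((1 + y.2) ^ (α / 3) : ℝ) : ℂ) * decayEvolution χ P charRoot₁ u₀ y.2 y.1)
          ∞ halfSpaceVolume
        ≤ C * l1ulocNorm u₀) := by
  obtain ⟨R, hR⟩ := exists_pos_eq_zero_of_lt_norm hχc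
  have ha := isSymbolOn_cutoff_mul hχ hR hP hp hQ hPQ
  have ham : Measurable fun ξ => χ ξ * P ξ :=
    measurable_of_continuousOn_compl_singleton 0 ha.1.continuousOn
  obtain ⟨c₁, hc₁, hre₁⟩ := exists_le_charRoot₁_re R
  obtain ⟨c₂, hc₂, hre₂⟩ := exists_le_charRoot₂_re R
  -- `λ₁ ~ |ξ|³` damps frequencies above `z ^ (-1/3)`, whence the length scale; `1 + z` in place of
  -- `z` ensures `L ≥ 1`.
  obtain ⟨hA₁, C₁, hB₁⟩ := decayEvolution_bounds (W := fun _ => 1)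
    (L := fun z => (1 + z) ^ (1 / 3 : ℝ)) hα ha hR (isSymbolOn_charRoot₁ R) hc₁
    (fun ξ _ h => hre₁ ξ h) (fun _ _ => zero_le_one)
    (fun z hz => Real.one_le_rpow (by linarith) (by norm_num))
    (fun γ hγ => exists_rpow_mul_exp_le_of_order_three hc₁ hγ)
  -- Smooth up to the origin with real part at least `c₂`: a symbol of order `b = 0`.
  have hexp : ∀ l : Plane → ℂ, ContDiff ℝ ∞ l → (∀ ξ, ‖ξ‖ ≤ R → c₂ ≤ (l ξ).re) → _ :=
    fun l hl hre => decayEvolution_bounds (W := fun z => Real.exp (-(c₂ / 2 * z)))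
      (L := fun _ => 1) hα ha hR (isSymbolOn_zero_of_contDiff hl R) hc₂
      (fun ξ _ h => by rw [Real.rpow_zero, mul_one]; exact hre ξ h)
      (fun z _ => (Real.exp_pos _).le) (fun _ _ => le_rfl)
      (fun γ hγ => exists_rpow_mul_exp_le_of_order_zero R c₂ γ hγ)
  obtain ⟨hA₂, C₂, hB₂⟩ := hexp charRoot₂ contDiff_charRoot₂ hre₂
  obtain ⟨hA₃, C₃, hB₃⟩ := hexp charRoot₃ contDiff_charRoot₃
    fun ξ h => by rw [charRoot₃_re]; exact hre₂ ξ h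
  refine ⟨?_, ?_, ?_⟩
  · rintro l (rfl | rfl | rfl)
    exacts [hA₁, hA₂, hA₃]
  · have hg : Measurable fun z : ℝ => Real.exp (c₂ / 2 * z) := by fun_prop
    have hgW : ∀ z : ℝ, 0 < z →
        |Real.exp (c₂ / 2 * z)| * (Real.exp (-(c₂ / 2 * z)) * 1 ^ (-α)) ≤ 1 := fun z _ => by
      rw [abs_of_pos (Real.exp_pos _), Real.one_rpow, mul_one, ← Real.exp_add, add_neg_cancel,
        Real.exp_zero]
    -- The rate `δ = c₂ / 2` is the half of the exponential decay not spent on the symbol bounds.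
    refine ⟨C₂ + C₃, c₂ / 2, by positivity, fun u₀ hu => ?_⟩
    have h₂ := memLp_top_mul_decayEvolution ham contDiff_charRoot₂.continuous.measurable hu hg hgW
      (hB₂ u₀ hu)
    have h₃ := memLp_top_mul_decayEvolution ham contDiff_charRoot₃.continuous.measurable hu hg hgW
      (hB₃ u₀ hu)
    refine ⟨h₂.1, h₃.1, (add_le_add h₂.2 h₃.2).trans (le_of_eq ?_)⟩
    rw [ENNReal.coe_add, add_mul]
  · refine ⟨C₁, fun u₀ hu => ?_⟩
    refine memLp_top_mul_decayEvolution ham (measurable_of_continuousOn_compl_singleton 0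
      (isSymbolOn_charRoot₁ R).1.continuousOn) hu (g := fun z => (1 + z) ^ (α / 3))
      (by fun_prop) (fun z hz => ?_) (hB₁ u₀ hu)
    have hz1 : 0 < 1 + z := by linarith
    rw [abs_of_pos (by positivity), one_mul, ← Real.rpow_mul hz1.le, ← Real.rpow_add hz1]
    have : α / 3 + 1 / 3 * -α = 0 := by ring
    rw [this, Real.rpow_zero]
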